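/- Let $G$ be a finite connected graph, loops and multiple edges allowed, with edge set $E$ and a fixed reference orientation. *Orientations.* An orientation of $G$ (a discrete orientation) directs every edge; it is identified with a point of $\{0,1\}^E$, the coordinate of $e$ being $1$ if $e$ is directed as in the reference orientation and $0$ otherwise. Points of $[0,1]^E$ are called continuous orientations; an edge is bi-oriented in such a point if its coordinate lies in $(0,1)$. A partial orientation, which directs the edges of a subset of $E$, is identified with a vector in $\{0,\pm1\}^E$; it is in an orientation $O$ if $O$ directs these edges in the same way. *Cycles and cocycles.* A cycle is a set of distinct edges $\{v_1v_2,\dots,v_{n-1}v_n,v_nv_1\}$ with $n\ge 1$ and $v_1,\dots,v_n$ distinct vertices. A directed cycle is a cycle with every edge directed from $v_i$ to $v_{i+1}$ (indices modulo $n$), or every edge directed the other way. A cocycle is an inclusion-minimal nonempty cut. A directed cocycle is a cocycle, the cut of a vertex set $W$, with all edges directed from $W$ to its complement, or all directed the other way. *Signatures.* A cycle signature $\sigma$ chooses a direction $\sigma(C)$ for each cycle $C$. It is acyclic if $\sum_C a_C\,\sigma(C)=0$ in $\mathbb R^E$ with all $a_C\ge 0$ forces all $a_C=0$. An orientation is $\sigma$-compatible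 if every directed cycle in it is one of the $\sigma(C)$. Acyclic cocycle signatures $\sigma^*$ and $\sigma^*$-compatible orientations are defined in the same way with cocycles. An orientation is $(\sigma,\sigma^*)$-compatible if it is both $\sigma$-compatible and $\sigma^*$-compatible. *The map $\varphi_{\sigma,\sigma^*}$.* Fix an acyclic cycle signature $\sigma$ and an acyclic cocycle signature $\sigma^*$. For a spanning tree $T$, let $g_{\sigma,\sigma^*}(T)$ be the orientation in which each $e\notin T$ is directed as in $\sigma(C)$, where $C$ is the unique cycle contained in $T\cup\{e\}$, and each $e\in T$ is directed as in $\sigma^*(C^*)$, where $C^*$ is the unique cocycle contained in $(E\setminus T)\cup\{e\}$. For an orientation $O$, choose a $(\sigma,\sigma^*)$-compatible orientation $O^{cp}$ and pairwise disjoint directed cycles $\vec C_i$ $(i\in I)$ and directed cocycles $\vec C^*_j$ $(j\in J)$ in $O^{cp}$ whose reversal turns $O^{cp}$ into $O$; let $T$ be the spanning tree with $g_{\sigma,\sigma^*}(T)=O^{cp}$, and put $$\varphi_{\sigma,\sigma^*}(O)=\Big(T\cup\bigcup_{i\in I}C_i\Big)\setminus\bigcup_{j\in J}C^*_j\subseteq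 E .$$ *Half-open cells.* For an orientation $O$ and $S\subseteq E$, let $\mathrm{hoc}(O,S)$ be the set of all $x\in[0,1]^E$ such that $x_e=O_e$ for every $e\notin S$, and $x_e=O_e$ or $x_e\in(0,1)$ for every $e\in S$. That is, the edges outside $S$ are oriented as in $O$, and the edges in $S$ are oriented as in $O$ or bi-oriented. **Theorem.** The map $\varphi_{\sigma,\sigma^*}$ is well defined: for every orientation $O$ the choices above exist, and the resulting set does not depend on them. Moreover, the cube is the disjoint union $$[0,1]^E=\biguplus_{O\in\{0,1\}^E}\mathrm{hoc}\big(O,\varphi_{\sigma,\sigma^*}(O)\big).$$ -/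

import Mathlib

open scoped Graph

namespace CubeTiling

section Graphs

variable {V E : Type*} (G : Graph V E)

/-- The spanning subgraph of `G` with edge set `T` (and all vertices of `G`) is connected. -/
def ConnectedBy (T : Set E(G)) : Prop :=
  V(G).Nonempty ∧ ∀ x ∈ V(G), ∀ y ∈ V(G),
    Relation.ReflTransGen (fun a b => ∃ e ∈ T, G.IsLink (e : E) a b) x y

/-- The multigraph `G` is connected. -/
def IsConnected : Prop := ConnectedBy G Set.univ

/-- `C` is a cycle: there are distinct vertices `v 0, …, v n` (`n ≥ 0`) and distinct edges `c i`
joining `v i` to `v (i + 1)`, indices taken cyclically, and `C` is the set of these edges.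
A loop is a cycle (`n = 0`), and so is a pair of parallel edges (`n = 1`). -/
def IsCycle (C : Set E(G)) : Prop :=
  ∃ (n : ℕ) (v : Fin (n + 1) → V) (c : Fin (n + 1) → E(G)),
    Function.Injective v ∧ Function.Injective c ∧
    (∀ i, G.IsLink (c i : E) (v i) (v (i + 1))) ∧ C = Set.range c

/-- The cut of `W`: the edges with one endpoint in `W` and the other one not in `W`. -/
def cut (W : Set V) : Set E(G) :=
  {e | ∃ x ∈ W, ∃ y ∉ W, G.IsLink (e : E) x y}

/-- `D` is a cocycle: a nonempty cut which is minimal for inclusion among the nonempty cuts. -/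
def IsCocycle (D : Set E(G)) : Prop :=
  Minimal (fun D' : Set E(G) => D'.Nonempty ∧ ∃ W : Set V, D' = cut G W) D

/-- `T` is (the edge set of) a spanning tree of `G`. -/
def IsSpanningTree (T : Set E(G)) : Prop :=
  ConnectedBy G T ∧ ∀ C, IsCycle G C → ¬ C ⊆ T

/-- For `e ∉ T`, with `T` a spanning tree: `C` is the fundamental cycle of `e`, i.e. the cycle
in `T ∪ {e}`. -/
def IsFundamentalCycle (T : Set E(G)) (e : E(G)) (C : Set E(G)) : Prop :=
  IsCycle G C ∧ C ⊆ T ∪ {e}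

/-- For `e ∈ T`, with `T` a spanning tree: `D` is the fundamental cocycle of `e`, i.e. the cocycle
in `(E ∖ T) ∪ {e}`. -/
def IsFundamentalCocycle (T : Set E(G)) (e : E(G)) (D : Set E(G)) : Prop :=
  IsCocycle G D ∧ D ⊆ Tᶜ ∪ {e}

/-- A reference orientation of `G`: every edge gets a tail and a head among its two ends. -/
structure ReferenceOrientation where
  /-- the tail of an edge -/
  tail : E(G) → V
  /-- the head of an edge -/
  head : E(G) → V
  isLink : ∀ e : E(G), G.IsLink (e : E) (tail e) (head e)

/-- Discrete orientations of `G`, i.e. the points of `{0,1}^E`: `true` (the coordinate `1`) means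
that the edge is directed as in the reference orientation, `false` (the coordinate `0`) that it is
directed oppositely. -/
abbrev DiscreteOrientation : Type _ := E(G) → Bool

/-- Partial orientations of `G` as `{0,±1}`-vectors: the value at `e` is `1` if `e` is directed as
in the reference orientation, `-1` if it is directed oppositely, and `0` if `e` is not directed.
The underlying edge set is `Function.support P`. -/
abbrev PartialOrientation : Type _ := E(G) → SignType

end Graphs

section Oriented

variable {V E : Type*} {G : Graph V E}

/-- `s = 1` or `s = -1`, and the edge `e` with the direction `s` is an arc from `x` to `y`.
(A loop is an arc from its vertex to itself for both directions.) -/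
def IsArc (R : ReferenceOrientation G) (e : E(G)) (s : SignType) (x y : V) : Prop :=
  (s = 1 ∧ R.tail e = x ∧ R.head e = y) ∨ (s = -1 ∧ R.head e = x ∧ R.tail e = y)

/-- `P` is a directed cycle: a cycle with all its edges directed from `v i` to `v (i + 1)`. -/
def IsDirectedCycle (R : ReferenceOrientation G) (P : PartialOrientation G) : Prop :=
  ∃ (n : ℕ) (v : Fin (n + 1) → V) (c : Fin (n + 1) → E(G)),
    Function.Injective v ∧ Function.Injective c ∧
    (∀ i, IsArc R (c i) (P (c i)) (v i) (v (i + 1))) ∧ Function.support P = Set.range c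

/-- `P` is a directed cocycle: a cocycle `cut G W` with all its edges directed from `W` to the
complement of `W`. -/
def IsDirectedCocycle (R : ReferenceOrientation G) (P : PartialOrientation G) : Prop :=
  ∃ W : Set V, IsCocycle G (cut G W) ∧ Function.support P = cut G W ∧
    ∀ e ∈ cut G W, ∃ x ∈ W, ∃ y ∉ W, IsArc R e (P e) x y

/-- A cycle signature: the choice of a direction for each cycle. -/
structure CycleSignature (R : ReferenceOrientation G) where
  /-- the chosen directed cycle -/
  dir : {C : Set E(G) // IsCycle G C} → PartialOrientation G
  isDirectedCycle : ∀ C, IsDirectedCycle R (dir C)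
  support_dir : ∀ C, Function.support (dir C) = C.1

/-- A cocycle signature: the choice of a direction for each cocycle. -/
structure CocycleSignature (R : ReferenceOrientation G) where
  /-- the chosen directed cocycle -/
  dir : {D : Set E(G) // IsCocycle G D} → PartialOrientation G
  isDirectedCocycle : ∀ D, IsDirectedCocycle R (dir D)
  support_dir : ∀ D, Function.support (dir D) = D.1

/-- The signature is acyclic: a nonnegative combination of the chosen directed cycles that is zero
in `ℝ^E` has all its coefficients zero. (The sum is finite, as `G` has finitely many edges.) -/
def CycleSignature.IsAcyclic {R : ReferenceOrientation G} (σ : CycleSignature R) : Prop :=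
  ∀ a : {C : Set E(G) // IsCycle G C} → ℝ, (∀ C, 0 ≤ a C) →
    (∀ e, ∑ᶠ C, a C * ((σ.dir C e : SignType) : ℝ) = 0) → ∀ C, a C = 0

/-- The signature is acyclic: a nonnegative combination of the chosen directed cocycles that is
zero in `ℝ^E` has all its coefficients zero. -/
def CocycleSignature.IsAcyclic {R : ReferenceOrientation G} (τ : CocycleSignature R) : Prop :=
  ∀ a : {D : Set E(G) // IsCocycle G D} → ℝ, (∀ D, 0 ≤ a D) →
    (∀ e, ∑ᶠ D, a D * ((τ.dir D e : SignType) : ℝ) = 0) → ∀ D, a D = 0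

/-- The direction of `e` in the discrete orientation `O`, as a sign. -/
def DiscreteOrientation.sign (O : DiscreteOrientation G) (e : E(G)) : SignType :=
  if O e then 1 else -1

/-- The partial orientation `P` is in the discrete orientation `O`. -/
def IsIn (P : PartialOrientation G) (O : DiscreteOrientation G) : Prop :=
  ∀ e ∈ Function.support P, P e = DiscreteOrientation.sign O e

/-- `O` is `σ`-compatible: every directed cycle in `O` is one of those chosen by `σ`. -/
def CycleSignature.Compatible {R : ReferenceOrientation G} (σ : CycleSignature R)
    (O : DiscreteOrientation G) : Prop :=
  ∀ P, IsDirectedCycle R P → IsIn P O → P ∈ Set.range σ.dir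

/-- `O` is `τ`-compatible: every directed cocycle in `O` is one of those chosen by `τ`. -/
def CocycleSignature.Compatible {R : ReferenceOrientation G} (τ : CocycleSignature R)
    (O : DiscreteOrientation G) : Prop :=
  ∀ P, IsDirectedCocycle R P → IsIn P O → P ∈ Set.range τ.dir

/-- `O` is the image of the spanning tree `T` under the geometric bijection of `σ` and `τ`: each
`e ∉ T` is directed as in the direction that `σ` gives to the fundamental cycle of `e`, and each
`e ∈ T` as in the direction that `τ` gives to the fundamental cocycle of `e`. -/
def IsGeometricImage {R : ReferenceOrientation G} (σ : CycleSignature R) (τ : CocycleSignature R)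
    (T : Set E(G)) (O : DiscreteOrientation G) : Prop :=
  IsSpanningTree G T ∧
  (∀ e ∉ T, ∃ C, IsFundamentalCycle G T e C.1 ∧ DiscreteOrientation.sign O e = σ.dir C e) ∧
  (∀ e ∈ T, ∃ D, IsFundamentalCocycle G T e D.1 ∧ DiscreteOrientation.sign O e = τ.dir D e)

/-- The union of the underlying edge sets of a family of partial orientations. -/
def edgesOf (F : Set (PartialOrientation G)) : Set E(G) := ⋃ P ∈ F, Function.support P

open Classical in
/-- The orientation obtained from `O` by reversing the edges in `A`. -/
noncomputable def reverse (A : Set E(G)) (O : DiscreteOrientation G) : DiscreteOrientation G :=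
  fun e => if e ∈ A then !(O e) else O e

/-- The relation that defines the extended geometric map: `O` is obtained from a `σ`- and
`τ`-compatible orientation `O'` by reversing pairwise disjoint directed cycles (the family `𝒞`)
and directed cocycles (the family `𝒟`) in `O'`, and `S = (T ∪ ⋃ 𝒞) ∖ ⋃ 𝒟`, where `T` is the spanning
tree that the geometric bijection sends to `O'`. -/
def IsExtendedImage {R : ReferenceOrientation G} (σ : CycleSignature R) (τ : CocycleSignature R)
    (O : DiscreteOrientation G) (S : Set E(G)) : Prop :=
  ∃ (O' : DiscreteOrientation G) (T : Set E(G)) (𝒞 𝒟 : Set (PartialOrientation G)),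
    σ.Compatible O' ∧ τ.Compatible O' ∧
    (∀ P ∈ 𝒞, IsDirectedCycle R P ∧ IsIn P O') ∧
    (∀ P ∈ 𝒟, IsDirectedCocycle R P ∧ IsIn P O') ∧
    𝒞.PairwiseDisjoint Function.support ∧ 𝒟.PairwiseDisjoint Function.support ∧
    Disjoint (edgesOf 𝒞) (edgesOf 𝒟) ∧
    O = reverse (edgesOf 𝒞 ∪ edgesOf 𝒟) O' ∧
    IsGeometricImage σ τ T O' ∧
    S = (T ∪ edgesOf 𝒞) \ edgesOf 𝒟

/-- The extended geometric map from discrete orientations to spanning subgraphs (given by their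
edge sets): the set `S` related to `O` by `IsExtendedImage`. -/
noncomputable def phi {R : ReferenceOrientation G} (σ : CycleSignature R) (τ : CocycleSignature R)
    (O : DiscreteOrientation G) : Set E(G) :=
  Classical.epsilon (IsExtendedImage σ τ O)

/-- The vertex of the cube `[0,1]^E` that corresponds to the discrete orientation `O`. -/
def DiscreteOrientation.toPoint (O : DiscreteOrientation G) : E(G) → ℝ :=
  fun e => if O e then 1 else 0

/-- The cube `[0,1]^E`, whose points are the continuous orientations of `G`. An edge is bi-oriented
in a continuous orientation if its coordinate lies in the open interval `(0,1)`. -/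
def cube (G : Graph V E) : Set (E(G) → ℝ) := Set.Icc 0 1

/-- The standard half-open cell `hoc(O, S)`: the continuous orientations in which each edge outside
`S` is oriented as in `O` and each edge in `S` is oriented as in `O` or bi-oriented. -/
def hoc (O : DiscreteOrientation G) (S : Set E(G)) : Set (E(G) → ℝ) :=
  {x | x ∈ cube G ∧
    (∀ e ∉ S, x e = DiscreteOrientation.toPoint O e) ∧
    (∀ e ∈ S, x e = DiscreteOrientation.toPoint O e ∨ x e ∈ Set.Ioo (0 : ℝ) 1)}

end Oriented

end CubeTiling

/-! Work in $\mathbb R^E$ with the flow space and its orthogonal companion, the cut space. Directed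
cycles and cocycles are their elementary sign vectors. Acyclicity of a signature says that the cone
of its vectors is pointed: it contains $v$ and $-v$ only for $v=0$. If $O=g(T)$, expansion in
fundamental cycles shows that every flow agreeing in sign with $O$ off $T$ lies in the cone of
$\sigma$, and dually for cut vectors agreeing with $O$ on $T$ (`Optimal`).

The heart is one rigidity statement (`Datum.Adjacent.eq`, `IsExtendedImage.eq_of_agree`): if
$(O_1,S_1)$ and $(O_2,S_2)$ both arise from the construction and $S_1,S_2$ agree at each edge where
$O_1,O_2$ differ, then the pairs are equal. Write $O_i=p_i-2c_i-2c_i'$ with $p_i$ compatible, $c_i$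
a flow and $c_i'$ a cut vector. Orthogonality makes $c_1,c_2'$ disjoint, then $\pm(c_2-c_1)$ both
lie in the cone, so $c_1=c_2$, and likewise $c_1'=c_2'$. Now $p_1,p_2$ agree on $T_1\triangle T_2$,
and Minty's painting lemma forces $T_1=T_2$.

All uniqueness claims follow. With $O_1=O_2$ it is independence of choices. A point common to two
cells is bi-oriented wherever $O_1,O_2$ differ, so these edges are in both sets and the cells
coincide. For covering, $\varphi$ is injective, hence bijective onto subsets of $E$, and an
injective self-map of the set of faces $\{*,0,1\}^E$ is surjective (`cube_subset_iUnion_hoc`).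

Existence has two halves. Moving an orientation maximally along each cone reaches a compatible one
(`exists_compatible_reversal`). A compatible orientation comes from a tree by a deletion-contraction
induction (`hasBasis_of_noBad`). -/

namespace CubeTiling

/-! ### Cones of sign vectors and optimal bases. -/

section SignVectors

variable {α ι : Type*}

/-- A sign vector as a real vector. -/
def toVec (P : α → SignType) : α → ℝ := fun e => (P e : ℝ)

lemma toVec_apply (P : α → SignType) (e : α) : toVec P e = (P e : ℝ) := rfl

lemma toVec_eq_zero_iff {P : α → SignType} {e : α} : toVec P e = 0 ↔ P e = 0 := by
  rw [toVec_apply]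
  generalize P e = s
  cases s <;> simp

lemma signType_coe_injective : Function.Injective (fun s : SignType => (s : ℝ)) := by
  intro s t h
  cases s <;> cases t <;> first | rfl | (norm_num [SignType.cast] at h)

lemma toVec_injective : Function.Injective (toVec : (α → SignType) → α → ℝ) := fun P Q h => by
  funext e
  exact signType_coe_injective (congrFun h e)

/-- The vector `v` is a nonnegative combination of the sign vectors `d i`. -/
def InCone [Fintype ι] (d : ι → α → SignType) (v : α → ℝ) : Prop :=
  ∃ a : ι → ℝ, (∀ i, 0 ≤ a i) ∧ ∀ e, v e = ∑ i, a i * toVec (d i) e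

/-- A family of sign vectors without nontrivial nonnegative linear relation. -/
def AcyclicFamily [Fintype ι] (d : ι → α → SignType) : Prop :=
  ∀ a : ι → ℝ, (∀ i, 0 ≤ a i) → (∀ e, ∑ i, a i * toVec (d i) e = 0) → ∀ i, a i = 0

section Cone

variable [Fintype ι] {d : ι → α → SignType} {v w : α → ℝ}

lemma InCone.zero : InCone d (0 : α → ℝ) := ⟨0, by simp, by simp⟩

lemma InCone.add (hv : InCone d v) (hw : InCone d w) : InCone d (v + w) := by
  obtain ⟨a, ha, hv⟩ := hv
  obtain ⟨b, hb, hw⟩ := hw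
  refine ⟨a + b, fun i => add_nonneg (ha i) (hb i), fun e => ?_⟩
  simp [hv, hw, add_mul, Finset.sum_add_distrib]

lemma InCone.smul {t : ℝ} (ht : 0 ≤ t) (hv : InCone d v) : InCone d (t • v) := by
  obtain ⟨a, ha, hv⟩ := hv
  refine ⟨t • a, fun i => mul_nonneg ht (ha i), fun e => ?_⟩
  simp [hv, Finset.mul_sum, mul_assoc]

lemma InCone.sum {κ : Type*} {s : Finset κ} {f : κ → α → ℝ} (h : ∀ k ∈ s, InCone d (f k)) :
    InCone d (∑ k ∈ s, f k) := by
  classical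
  induction s using Finset.induction_on with
  | empty => simpa using InCone.zero
  | insert k s hk ih =>
    rw [Finset.sum_insert hk]
    exact (h k (by simp)).add (ih fun j hj => h j (by simp [hj]))

lemma inCone_single (i : ι) : InCone d (toVec (d i)) := by
  classical
  refine ⟨Pi.single i 1, fun j => ?_, fun e => ?_⟩
  · by_cases h : j = i
    · subst h; simp
    · simp [h]
  · simp [Pi.single_apply]

/-- Adding the two representations gives a nonnegative relation, so all coefficients vanish.
Acyclicity enters the uniqueness arguments through this pointedness of the cone. -/
lemma AcyclicFamily.eq_zero (hd : AcyclicFamily d) (hv : InCone d v) (hv' : InCone d (-v)) :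
    v = 0 := by
  obtain ⟨a, ha, hv⟩ := hv
  obtain ⟨b, hb, hv'⟩ := hv'
  have h := hd (a + b) (fun i => add_nonneg (ha i) (hb i)) fun e => by
    simp only [Pi.add_apply, add_mul, Finset.sum_add_distrib]
    rw [← hv, ← hv']
    simp
  have ha0 : ∀ i, a i = 0 := fun i => by
    have h1 := h i
    simp only [Pi.add_apply] at h1
    linarith [ha i, hb i]
  funext e
  simp [hv, ha0]

lemma InCone.mem {Z : Submodule ℝ (α → ℝ)} (hdZ : ∀ i, toVec (d i) ∈ Z) (hv : InCone d v) :
    v ∈ Z := by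
  obtain ⟨a, -, hv⟩ := hv
  have : v = ∑ i, a i • toVec (d i) := by
    funext e
    simp [hv]
  rw [this]
  exact Z.sum_mem fun i _ => Z.smul_mem _ (hdZ i)

/-- If every `e ∉ T` has a fundamental vector `d i` whose sign at `e` is `p e`, then the vectors
of `Z` that agree in sign with `p` outside `T` are in the cone. -/
lemma inCone_of_fundamental [Fintype α] {Z : Submodule ℝ (α → ℝ)} {T : Set α} {p : α → ℝ}
    (hp : ∀ e, p e = 1 ∨ p e = -1) (hdZ : ∀ i, toVec (d i) ∈ Z)
    (hT : ∀ v ∈ Z, (∀ e ∉ T, v e = 0) → v = 0)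
    (hfund : ∀ e ∉ T, ∃ i, toVec (d i) e = p e ∧ ∀ f ∉ T, f ≠ e → d i f = 0)
    (hv : v ∈ Z) (hsign : ∀ e ∉ T, 0 ≤ v e * p e) : InCone d v := by
  classical
  -- `choose!` below needs a default index; if there is none, no element lies outside `T`.
  rcases isEmpty_or_nonempty ι with hι | hι
  · rw [hT v hv fun e he => isEmptyElim (hfund e he).choose]
    exact InCone.zero
  choose! i hi hi' using hfund
  set s : Finset α := Finset.univ.filter (· ∉ T) with hs
  have hcone : InCone d (∑ e ∈ s, (v e * p e) • toVec (d (i e))) :=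
    InCone.sum fun e he => (inCone_single _).smul (hsign e (by simpa [hs] using he))
  -- The fundamental vectors are diagonal off `T`, and `p f * p f = 1`, so this combination matches
  -- `v` off `T`; a vector of `Z` supported in `T` is zero.
  have hzero := hT (v - ∑ e ∈ s, (v e * p e) • toVec (d (i e)))
    (Z.sub_mem hv (hcone.mem hdZ)) fun f hf => by
      have h1 : ∑ e ∈ s, (v e * p e) * toVec (d (i e)) f
          = (v f * p f) * toVec (d (i f)) f := by
        refine Finset.sum_eq_single f (fun e he hef => ?_) fun h => absurd (by simp [hs, hf]) h
        rw [toVec_apply, hi' e (by simpa [hs] using he) f hf (Ne.symm hef)]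
        simp
      have h2 : p f * p f = 1 := by rcases hp f with h | h <;> simp [h]
      simp only [Pi.sub_apply, Finset.sum_apply, Pi.smul_apply, smul_eq_mul]
      rw [h1, hi f hf, mul_assoc, h2]
      ring
  rw [sub_eq_zero.1 hzero]
  exact hcone

end Cone

/-- The painting property of a pair of spaces: for disjoint sets `A` of elements free
for `Z` and `B` of elements with a prescribed sign, every `e ∈ B` is in the support of a suitable
vector of `Z` or `Z'`. -/
def PaintingProperty (Z Z' : Submodule ℝ (α → ℝ)) : Prop :=
  ∀ (A B : Set α) (s : α → ℝ), Disjoint A B → (∀ e, s e = 1 ∨ s e = -1) → ∀ e₀ ∈ B,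
    (∃ v ∈ Z, v e₀ ≠ 0 ∧ (∀ e ∉ A ∪ B, v e = 0) ∧ ∀ e ∈ B, 0 ≤ v e * s e) ∨
    (∃ u ∈ Z', u e₀ ≠ 0 ∧ (∀ e ∈ A, u e = 0) ∧ ∀ e ∈ B, 0 ≤ u e * s e)

/-- The basis `T` with the signs `p` is optimal for the family `d`. -/
def Optimal [Fintype ι] (Z : Submodule ℝ (α → ℝ)) (d : ι → α → SignType) (T : Set α)
    (p : α → ℝ) : Prop :=
  ∀ v ∈ Z, (∀ e ∉ T, 0 ≤ v e * p e) → InCone d v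

/-- The signs of an optimal basis are those of its fundamental vectors. -/
lemma Optimal.sign_eq [Fintype ι] {Z : Submodule ℝ (α → ℝ)}
    {d : ι → α → SignType} {T : Set α} {p q : α → ℝ} (h : Optimal Z d T q)
    (hd : AcyclicFamily d) {i : ι} (hi : toVec (d i) ∈ Z) (hp : ∀ e, p e = 1 ∨ p e = -1)
    (hq : ∀ e, q e = 1 ∨ q e = -1) {e : α} (hie : toVec (d i) e = p e)
    (hi0 : ∀ f ∉ T, f ≠ e → d i f = 0) : p e = q e := by
  by_contra hne
  have hpq : q e = - p e := by
    rcases hp e with h1 | h1 <;> rcases hq e with h2 | h2 <;> simp_all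
  -- If the signs differed at `e`, then `-d i` would agree with `q` off `T`, so both `d i` and its
  -- negative would lie in the cone.
  have h0 := hd.eq_zero (inCone_single i) (h _ (Z.neg_mem hi) fun f hf => by
    by_cases hfe : f = e
    · subst hfe
      rw [Pi.neg_apply, hie, hpq, neg_mul_neg]
      exact mul_self_nonneg _
    · simp [toVec_apply, hi0 f hf hfe])
  rw [h0] at hie
  rcases hp e with h1 | h1 <;> simp [h1] at hie

/-! ### The key lemma: adjacent data coincide. -/

section KeyLemma

variable {κ : Type*} [Fintype ι] [Fintype κ] {Z Z' : Submodule ℝ (α → ℝ)}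
  {d : ι → α → SignType} {d' : κ → α → SignType}

/-- Two optimal bases whose sign vectors agree on their symmetric difference are equal. -/
lemma basis_eq_of_agree (hpaint : PaintingProperty Z Z') (hd : AcyclicFamily d)
    (hd' : AcyclicFamily d') {T₁ T₂ : Set α} {p₁ p₂ : α → ℝ} (hp₁ : ∀ e, p₁ e = 1 ∨ p₁ e = -1)
    (h₁ : Optimal Z d T₁ p₁) (h₁' : Optimal Z' d' T₁ᶜ p₁)
    (h₂ : Optimal Z d T₂ p₂) (h₂' : Optimal Z' d' T₂ᶜ p₂)
    (hagree : ∀ e, ¬ (e ∈ T₁ ↔ e ∈ T₂) → p₁ e = p₂ e) : T₁ = T₂ := by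
  classical
  by_contra hne
  obtain ⟨e₀, he₀⟩ : ∃ e, ¬ (e ∈ T₁ ↔ e ∈ T₂) := by
    by_contra! h
    exact hne (Set.ext h)
  -- Flipping the sign on `T₁ \ T₂` makes `v` agree with `p₁` off `T₁` and `-v` with `p₂` off `T₂`.
  -- In the dual case `u` agrees with `p₂` on `T₂` and `-u` with `p₁` on `T₁`. Either way
  -- pointedness gives zero.
  rcases hpaint (T₁ ∩ T₂) {e | ¬ (e ∈ T₁ ↔ e ∈ T₂)}
    (fun e => if e ∈ T₁ then -p₁ e else p₁ e)
    (Set.disjoint_left.2 fun e he he' => he' (by simp [he.1, he.2]))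
    (fun e => by split_ifs <;> rcases hp₁ e with h | h <;> simp [h]) e₀ he₀ with
    ⟨v, hv, hv0, hvz, hvs⟩ | ⟨u, hu, hu0, huz, hus⟩
  · refine hv0 (congrFun (hd.eq_zero (h₁ v hv fun e he => ?_)
      (h₂ (-v) (Z.neg_mem hv) fun e he => ?_)) e₀)
    · by_cases he2 : e ∈ T₂
      · simpa [he] using hvs e (by simp [he, he2])
      · simp [hvz e (by simp [he, he2])]
    · by_cases he1 : e ∈ T₁
      · have := hvs e (by simp [he, he1])
        rw [← hagree e (by simp [he, he1])]
        simpa [he1] using this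
      · simp [hvz e (by simp [he, he1])]
  · refine hu0 (congrFun (hd'.eq_zero (h₂' u hu fun e he => ?_)
      (h₁' (-u) (Z'.neg_mem hu) fun e he => ?_)) e₀)
    · have he2 : e ∈ T₂ := by simpa using he
      by_cases he1 : e ∈ T₁
      · simp [huz e ⟨he1, he2⟩]
      · rw [← hagree e (by simp [he2, he1])]
        simpa [he1] using hus e (by simp [he2, he1])
    · have he1 : e ∈ T₁ := by simpa using he
      by_cases he2 : e ∈ T₂
      · simp [huz e ⟨he1, he2⟩]
      · simpa [he1] using hus e (by simp [he2, he1])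

/-- A basis, a compatible sign vector `p`, a vector `c` of `Z` and a vector `c'` of `Z'`
describing disjoint sets of coordinates of `p` that are to be negated. -/
structure Datum (Z Z' : Submodule ℝ (α → ℝ)) (d : ι → α → SignType) (d' : κ → α → SignType) where
  /-- the basis -/
  T : Set α
  /-- the compatible sign vector -/
  p : α → ℝ
  /-- the coordinates negated along `Z` -/
  c : α → ℝ
  /-- the coordinates negated along `Z'` -/
  c' : α → ℝ
  sign : ∀ e, p e = 1 ∨ p e = -1
  mem : c ∈ Z
  mem' : c' ∈ Z'
  conformal : ∀ e, c e = 0 ∨ c e = p e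
  conformal' : ∀ e, c' e = 0 ∨ c' e = p e
  disjoint : ∀ e, c e = 0 ∨ c' e = 0
  optimal : Optimal Z d T p
  optimal' : Optimal Z' d' Tᶜ p

/-- The sign vector obtained by negating. -/
def Datum.o (D : Datum Z Z' d d') : α → ℝ := fun e => p D e - 2 * c D e - 2 * c' D e

/-- The set attached to a datum. -/
def Datum.S (D : Datum Z Z' d d') : Set α := {e | (e ∈ D.T ∨ D.c e ≠ 0) ∧ D.c' e = 0}

lemma Datum.o_of_c_ne (D : Datum Z Z' d d') {e : α} (h : D.c e ≠ 0) : D.o e = - D.c e := by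
  have h1 := (D.conformal e).resolve_left h
  have h2 := (D.disjoint e).resolve_left h
  rw [Datum.o, h2, ← h1]
  ring

lemma Datum.o_of_c'_ne (D : Datum Z Z' d d') {e : α} (h : D.c' e ≠ 0) : D.o e = - D.c' e := by
  have h1 := (D.conformal' e).resolve_left h
  have h2 := (D.disjoint e).resolve_right h
  rw [Datum.o, h2, ← h1]
  ring

lemma Datum.o_of_eq (D : Datum Z Z' d d') {e : α} (h : D.c e = 0) (h' : D.c' e = 0) :
    D.o e = D.p e := by
  rw [Datum.o, h, h']
  ring

lemma Datum.mem_S_of_c_ne (D : Datum Z Z' d d') {e : α} (h : D.c e ≠ 0) : e ∈ D.S :=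
  ⟨Or.inr h, (D.disjoint e).resolve_left h⟩

lemma Datum.notMem_S_of_c'_ne (D : Datum Z Z' d d') {e : α} (h : D.c' e ≠ 0) : e ∉ D.S :=
  fun h1 => h h1.2

/-- Whenever the sign vectors of the two data differ at `e`, the sets agree at `e`. -/
def Datum.Adjacent (D₁ D₂ : Datum Z Z' d d') : Prop :=
  ∀ e, D₁.o e ≠ D₂.o e → (e ∈ D₁.S ↔ e ∈ D₂.S)

lemma Datum.Adjacent.symm {D₁ D₂ : Datum Z Z' d d'} (h : D₁.Adjacent D₂) : D₂.Adjacent D₁ :=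
  fun e he => (h e he.symm).symm

/-- Used with `x` and `y` the entries of the vectors `c` (or `c'`) of two data: where `x = p` the
bound `|y| ≤ 1` suffices, so only `x = 0` needs adjacency. -/
lemma sub_mul_nonneg_of_conformal {x y p : ℝ} (hx : x = 0 ∨ x = p) (hp : p = 1 ∨ p = -1)
    (hy : y = 0 ∨ y = 1 ∨ y = -1) (h : x = 0 → y ≠ 0 → p = -y) : 0 ≤ (x - y) * p := by
  rcases hx with rfl | rfl
  · by_cases hy0 : y = 0
    · simp [hy0]
    · rw [h rfl hy0]
      nlinarith [mul_self_nonneg y]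
  · rcases hp with rfl | rfl <;> rcases hy with rfl | rfl | rfl <;> norm_num

lemma Datum.c_values (D : Datum Z Z' d d') (e : α) : D.c e = 0 ∨ D.c e = 1 ∨ D.c e = -1 := by
  rcases D.conformal e with h | h
  · exact Or.inl h
  · rw [h]; exact Or.inr (D.sign e)

lemma Datum.c'_values (D : Datum Z Z' d d') (e : α) :
    D.c' e = 0 ∨ D.c' e = 1 ∨ D.c' e = -1 := by
  rcases D.conformal' e with h | h
  · exact Or.inl h
  · rw [h]; exact Or.inr (D.sign e)

variable [Fintype α] {D₁ D₂ : Datum Z Z' d d'}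

/-- On a common support `e` is in `D₁.S` but not in `D₂.S`, so the two sign vectors agree there and
the product is nonnegative. A sum of nonnegative terms that vanishes by orthogonality has only zero
terms. -/
lemma Datum.Adjacent.c_mul_c' (horth : ∀ v ∈ Z, ∀ u ∈ Z', ∑ e, v e * u e = 0)
    (h : D₁.Adjacent D₂) (e : α) : D₁.c e = 0 ∨ D₂.c' e = 0 := by
  have hnonneg : ∀ e ∈ Finset.univ, 0 ≤ D₁.c e * D₂.c' e := fun e _ => by
    by_cases h1 : D₁.c e = 0
    · simp [h1]
    by_cases h2 : D₂.c' e = 0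
    · simp [h2]
    have ho : D₁.o e = D₂.o e := by
      by_contra hne
      exact D₂.notMem_S_of_c'_ne h2 ((h e hne).1 (D₁.mem_S_of_c_ne h1))
    rw [D₁.o_of_c_ne h1, D₂.o_of_c'_ne h2, neg_inj] at ho
    rw [ho]
    exact mul_self_nonneg _
  have := (Finset.sum_eq_zero_iff_of_nonneg hnonneg).1 (horth _ D₁.mem _ D₂.mem') e
    (Finset.mem_univ e)
  exact mul_eq_zero.1 this

lemma Datum.Adjacent.inCone_sub (horth : ∀ v ∈ Z, ∀ u ∈ Z', ∑ e, v e * u e = 0)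
    (h : D₁.Adjacent D₂) : InCone d (D₂.c - D₁.c) := by
  refine D₂.optimal _ (Z.sub_mem D₂.mem D₁.mem) fun e he => ?_
  refine sub_mul_nonneg_of_conformal (D₂.conformal e) (D₂.sign e) (D₁.c_values e) fun h2 h1 => ?_
  have h3 := (h.c_mul_c' horth e).resolve_left h1
  -- Here `e` is in `D₁.S` through `c`, but outside `D₂.S`, being neither in the basis nor in the
  -- support of `D₂.c`.
  have ho : D₁.o e = D₂.o e := by
    by_contra hne
    rcases ((h e hne).1 (D₁.mem_S_of_c_ne h1)).1 with h4 | h4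
    exacts [he h4, h4 h2]
  rw [D₁.o_of_c_ne h1, D₂.o_of_eq h2 h3] at ho
  exact ho.symm

lemma Datum.Adjacent.inCone_sub' (horth : ∀ v ∈ Z, ∀ u ∈ Z', ∑ e, v e * u e = 0)
    (h : D₁.Adjacent D₂) : InCone d' (D₂.c' - D₁.c') := by
  refine D₂.optimal' _ (Z'.sub_mem D₂.mem' D₁.mem') fun e he => ?_
  have he : e ∈ D₂.T := by simpa using he
  refine sub_mul_nonneg_of_conformal (D₂.conformal' e) (D₂.sign e) (D₁.c'_values e)
    fun h2 h1 => ?_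
  have h3 := (h.symm.c_mul_c' horth e).resolve_right h1
  -- Dually, `c'` removes `e` from `D₁.S`, while `e` stays in `D₂.S` through the basis.
  have ho : D₁.o e = D₂.o e := by
    by_contra hne
    exact D₁.notMem_S_of_c'_ne h1 ((h e hne).2 ⟨Or.inl he, h2⟩)
  rw [D₁.o_of_c'_ne h1, D₂.o_of_eq h3 h2] at ho
  exact ho.symm

/-- Adjacent data have the same vectors `c` and `c'` and the same basis. -/
lemma Datum.Adjacent.eq (hpaint : PaintingProperty Z Z')
    (horth : ∀ v ∈ Z, ∀ u ∈ Z', ∑ e, v e * u e = 0) (hd : AcyclicFamily d)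
    (hd' : AcyclicFamily d') (h : D₁.Adjacent D₂) :
    D₁.c = D₂.c ∧ D₁.c' = D₂.c' ∧ D₁.T = D₂.T := by
  have hc : D₁.c = D₂.c := sub_eq_zero.1 <| hd.eq_zero (h.symm.inCone_sub horth)
    (by rw [neg_sub]; exact h.inCone_sub horth)
  have hc' : D₁.c' = D₂.c' := sub_eq_zero.1 <| hd'.eq_zero (h.symm.inCone_sub' horth)
    (by rw [neg_sub]; exact h.inCone_sub' horth)
  refine ⟨hc, hc', basis_eq_of_agree hpaint hd hd' D₁.sign D₁.optimal D₁.optimal' D₂.optimal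
    D₂.optimal' fun e he => ?_⟩
  by_cases h1 : D₁.c e = 0
  · by_cases h2 : D₁.c' e = 0
    -- Where nothing is negated, `S` coincides with the basis and `o` with `p`; so if the bases
    -- differ at `e`, adjacency makes the signs agree.
    · rw [← D₁.o_of_eq h1 h2, ← D₂.o_of_eq (by rw [← hc, h1]) (by rw [← hc', h2])]
      by_contra hne
      have := h e hne
      simp only [Datum.S, ← hc, ← hc', h1, h2, Set.mem_ofPred_eq, ne_eq, not_true_eq_false,
        or_false, and_true] at this
      exact he this
    · rw [← (D₁.conformal' e).resolve_left h2, hc',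
        ← (D₂.conformal' e).resolve_left (by rwa [← hc'])]
  · rw [← (D₁.conformal e).resolve_left h1, hc, ← (D₂.conformal e).resolve_left (by rwa [← hc])]

end KeyLemma

end SignVectors

/-! ### Compatible sign vectors come from bases: deletion and contraction. -/

section Bases

variable {α ι κ : Type*}

/-- No vector `-d i` that vanishes on `D` agrees in sign with `p` outside `F ∪ D`. -/
def NoBad (d : ι → α → SignType) (F D : Set α) (p : α → ℝ) : Prop :=
  ∀ i, (∀ e ∈ D, d i e = 0) → ¬ ∀ e, e ∉ F → e ∉ D → 0 ≤ -toVec (d i) e * p e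

lemma NoBad.insert_right {d : ι → α → SignType} {F D : Set α} {p : α → ℝ} (h : NoBad d F D p)
    (e : α) : NoBad d F (insert e D) p := fun i hi hs => by
  refine h i (fun f hf => hi f (Or.inr hf)) fun f hfF hfD => ?_
  by_cases hfe : f = e
  · rw [toVec_apply, hi f (Or.inl hfe)]; simp
  · exact hs f hfF (by simp [hfe, hfD])

lemma NoBad.congr {d : ι → α → SignType} {F D : Set α} {p q : α → ℝ} (h : NoBad d F D p)
    (hpq : ∀ e, e ∉ F → e ∉ D → p e = q e) : NoBad d F D q := fun i hi hs =>
  h i hi fun e heF heD => by rw [hpq e heF heD]; exact hs e heF heD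

lemma Optimal.noBad [Fintype ι] {Z : Submodule ℝ (α → ℝ)} {d : ι → α → SignType} {T F D : Set α}
    {p : α → ℝ} (h : Optimal Z d T p) (hd : AcyclicFamily d) (hdZ : ∀ i, toVec (d i) ∈ Z)
    (hd0 : ∀ i, d i ≠ 0) (hF : F ⊆ T) : NoBad d F D p := fun i hi hs => by
  refine hd0 i (funext fun e => toVec_eq_zero_iff.1 (congrFun (hd.eq_zero (inCone_single i)
    (h _ (Z.neg_mem (hdZ i)) fun f hf => ?_)) e))
  by_cases hfD : f ∈ D
  · simp [toVec_apply, hi f hfD]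
  · exact hs f (fun h => hf (hF h)) hfD

/-- Think of `F` as contracted and `D` as deleted. If both enlargements by `e` failed, the two bad
vectors would both disagree with `p` at `e` and nowhere else outside `F ∪ D`. Their inner product
would then be positive, against orthogonality. -/
lemma NoBad.insert_or_insert [Fintype α] {d : ι → α → SignType} {d' : κ → α → SignType}
    (horth : ∀ i j, ∑ e, toVec (d i) e * toVec (d' j) e = 0) {F D : Set α} {p : α → ℝ}
    (hp : ∀ e, p e = 1 ∨ p e = -1) (h : NoBad d F D p) (h' : NoBad d' D F p) (e : α) :
    NoBad d (insert e F) D p ∨ NoBad d' (insert e D) F p := by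
  by_contra! hcon
  obtain ⟨h1, h2⟩ := hcon
  unfold NoBad at h1 h2
  push Not at h1 h2
  obtain ⟨i, hi, hi'⟩ := h1
  obtain ⟨j, hj, hj'⟩ := h2
  have hie : -toVec (d i) e * p e < 0 := by
    by_contra! hcon
    refine h i hi fun f hfF hfD => ?_
    by_cases hfe : f = e
    · exact hfe ▸ hcon
    · exact hi' f (by simp [hfe, hfF]) hfD
  have hje : -toVec (d' j) e * p e < 0 := by
    by_contra! hcon
    refine h' j hj fun f hfD hfF => ?_
    by_cases hfe : f = e
    · exact hfe ▸ hcon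
    · exact hj' f (by simp [hfe, hfD]) hfF
  have key : ∀ f, toVec (d i) f * toVec (d' j) f
      = (-toVec (d i) f * p f) * (-toVec (d' j) f * p f) := fun f => by
    rcases hp f with h | h <;> rw [h] <;> ring
  have : 0 < ∑ e, toVec (d i) e * toVec (d' j) e := by
    refine Finset.sum_pos' (fun f _ => ?_) ⟨e, Finset.mem_univ e, ?_⟩
    · rw [key]
      by_cases hfe : f = e
      · subst hfe
        exact (mul_pos_of_neg_of_neg hie hje).le
      by_cases hfF : f ∈ F
      · simp [toVec_apply, hj f hfF]
      by_cases hfD : f ∈ D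
      · simp [toVec_apply, hi f hfD]
      exact mul_nonneg (hi' f (by simp [hfe, hfF]) hfD) (hj' f (by simp [hfe, hfD]) hfF)
    · rw [key]
      exact mul_pos_of_neg_of_neg hie hje
  exact this.ne' (horth i j)

/-- Among the pairs satisfying `B` there is one whose basis contains `F` and avoids `D`, and whose
sign vector is `p` outside `F ∪ D`. -/
def HasBasis (B : Set α → (α → ℝ) → Prop) (F D : Set α) (p : α → ℝ) : Prop :=
  ∃ T q, B T q ∧ F ⊆ T ∧ D ⊆ Tᶜ ∧ ∀ e, e ∉ F → e ∉ D → q e = p e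

lemma HasBasis.compl {B : Set α → (α → ℝ) → Prop} {F D : Set α} {p : α → ℝ}
    (h : HasBasis B F D p) : HasBasis (fun T q => B Tᶜ q) D F p := by
  obtain ⟨T, q, hB, hF, hD, h⟩ := h
  exact ⟨Tᶜ, q, by simpa using hB, hD, by rwa [compl_compl], fun e h1 h2 => h e h2 h1⟩

/-- The basis containing `e` may carry the wrong sign at `e`. In that case deletion of `e` is also
possible, and the resulting basis must carry the right sign, since otherwise the two bases would
agree on their symmetric difference and be equal, though only one contains `e`. -/
lemma hasBasis_of_insert {B : Set α → (α → ℝ) → Prop} {d' : κ → α → SignType}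
    (hBs : ∀ T q, B T q → ∀ e, q e = 1 ∨ q e = -1)
    (hB' : ∀ T q, B T q → ∀ F D : Set α, F ⊆ T → D ⊆ Tᶜ → NoBad d' D F q)
    (huniq : ∀ T q T' q', B T q → B T' q' → (∀ e, ¬ (e ∈ T ↔ e ∈ T') → q e = q' e) → T = T')
    {F D : Set α} {p : α → ℝ} (hp : ∀ e, p e = 1 ∨ p e = -1) {e : α}
    (hF : HasBasis B (insert e F) D p) (hbad : NoBad d' D F p)
    (hD : NoBad d' (insert e D) F p → HasBasis B F (insert e D) p) : HasBasis B F D p := by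
  obtain ⟨T, q, hT, hFT, hDT, hq⟩ := hF
  have hFT' := (Set.insert_subset_iff.1 hFT)
  have hq' : ∀ f, f ≠ e → f ∉ F → f ∉ D → q f = p f := fun f h1 h2 h3 =>
    hq f (by simp [h1, h2]) h3
  by_cases hqe : q e = p e
  · refine ⟨T, q, hT, hFT'.2, hDT, fun f hf hf' => ?_⟩
    by_cases hfe : f = e
    · rw [hfe, hqe]
    · exact hq' f hfe hf hf'
  have hqe' : q e = - p e := by
    rcases hBs T q hT e with h | h <;> rcases hp e with h' | h' <;> simp_all
  -- `q` and `p` have opposite signs at `e`, so a vector bad after deletion of `e` would already be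
  -- bad for `p` or for `q`.
  obtain ⟨T', r, hT', hFT'', hDT'', hr⟩ := hD fun j hj hs => by
    rcases le_total 0 (-toVec (d' j) e * p e) with h | h
    · refine hbad j hj fun f hfD hfF => ?_
      by_cases hfe : f = e
      · exact hfe ▸ h
      · exact hs f (by simp [hfe, hfD]) hfF
    · refine hB' T q hT F D hFT'.2 hDT j hj fun f hfD hfF => ?_
      by_cases hfe : f = e
      · rw [hfe, hqe']
        linarith
      · rw [hq' f hfe hfF hfD]
        exact hs f (by simp [hfe, hfD]) hfF
  have hDT3 := (Set.insert_subset_iff.1 hDT'')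
  have hr' : ∀ f, f ≠ e → f ∉ F → f ∉ D → r f = p f := fun f h1 h2 h3 =>
    hr f h2 (by simp [h1, h3])
  by_cases hre : r e = p e
  · refine ⟨T', r, hT', hFT'', hDT3.2, fun f hf hf' => ?_⟩
    by_cases hfe : f = e
    · rw [hfe, hre]
    · exact hr' f hfe hf hf'
  have hre' : r e = - p e := by
    rcases hBs T' r hT' e with h | h <;> rcases hp e with h' | h' <;> simp_all
  have hTT := huniq T q T' r hT hT' fun f hf => by
    by_cases hfe : f = e
    · rw [hfe, hqe', hre']
    · have h1 : f ∉ F := fun h => hf (by simp [hFT'.2 h, hFT'' h])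
      have h2 : f ∉ D := fun h => hf (iff_of_false (hDT h) (hDT3.2 h))
      rw [hq' f hfe h1 h2, hr' f hfe h1 h2]
  exact absurd (hTT ▸ hFT'.1) hDT3.1

/-- Existence of a basis for a compatible sign vector, relative to a set `F` of elements forced to
be in the basis and a set `D` of elements forced to be outside. -/
lemma hasBasis_of_noBad [Fintype α] {B : Set α → (α → ℝ) → Prop}
    {d : ι → α → SignType} {d' : κ → α → SignType}
    (horth : ∀ i j, ∑ e, toVec (d i) e * toVec (d' j) e = 0)
    (hBs : ∀ T q, B T q → ∀ e, q e = 1 ∨ q e = -1)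
    (hB : ∀ T q, B T q → ∀ F D : Set α, F ⊆ T → D ⊆ Tᶜ → NoBad d F D q)
    (hB' : ∀ T q, B T q → ∀ F D : Set α, F ⊆ T → D ⊆ Tᶜ → NoBad d' D F q)
    (huniq : ∀ T q T' q', B T q → B T' q' → (∀ e, ¬ (e ∈ T ↔ e ∈ T') → q e = q' e) → T = T')
    (hbase : ∀ T : Set α, (∀ i, ¬ ∀ e ∉ T, d i e = 0) → (∀ j, ¬ ∀ e ∈ T, d' j e = 0) →
      ∃ q, B T q)
    {p : α → ℝ} (hp : ∀ e, p e = 1 ∨ p e = -1) {F D : Set α} (hFD : Disjoint F D)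
    (h : NoBad d F D p) (h' : NoBad d' D F p) : HasBasis B F D p := by
  induction hn : (F ∪ D)ᶜ.ncard generalizing F D with
  | zero =>
    -- Everything is decided: no sign condition remains, and absence of bad vectors says that no `d
    -- i` lives in `F` and no `d' j` in its complement.
    rw [Set.ncard_eq_zero, Set.compl_empty_iff] at hn
    have hD : ∀ e, e ∉ F ↔ e ∈ D := fun e =>
      ⟨fun he => (hn.ge (Set.mem_univ e)).resolve_left he,
        fun he he' => Set.disjoint_left.1 hFD he' he⟩
    obtain ⟨q, hq⟩ := hbase F
      (fun i hi => h i (fun e he => hi e ((hD e).2 he)) fun e h1 h2 => absurd ((hD e).1 h1) h2)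
      (fun j hj => h' j hj fun e h1 h2 => absurd ((hD e).1 h2) h1)
    exact ⟨F, q, hq, subset_rfl, fun e he => (hD e).2 he, fun e h1 h2 => absurd ((hD e).1 h1) h2⟩
  | succ n ih =>
    obtain ⟨e, he⟩ : (F ∪ D)ᶜ.Nonempty := by
      rw [← Set.ncard_pos]; omega
    have heF : e ∉ F := fun h => he (Or.inl h)
    have heD : e ∉ D := fun h => he (Or.inr h)
    have hcard : (insert e (F ∪ D))ᶜ.ncard = n := by
      have h1 : (insert e (F ∪ D))ᶜ = (F ∪ D)ᶜ \ {e} := by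
        ext f; simp [not_or]; tauto
      rw [h1, Set.ncard_sdiff_singleton_of_mem he, hn]
      rfl
    have ihF : NoBad d (insert e F) D p → HasBasis B (insert e F) D p := fun hbad =>
      ih (Set.disjoint_insert_left.2 ⟨heD, hFD⟩) hbad (h'.insert_right e)
        (by rw [Set.insert_union]; exact hcard)
    have ihD : NoBad d' (insert e D) F p → HasBasis B F (insert e D) p := fun hbad =>
      ih (Set.disjoint_insert_right.2 ⟨heF, hFD⟩) (h.insert_right e) hbad
        (by rw [Set.union_insert]; exact hcard)
    rcases NoBad.insert_or_insert horth hp h h' e with hc | hc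
    · exact hasBasis_of_insert hBs hB' huniq hp (ihF hc) h' ihD
    -- The same argument in the dual, with complements of bases and `d`, `d'` exchanged.
    · have := hasBasis_of_insert (B := fun T q => B Tᶜ q) (d' := d) (fun T q => hBs Tᶜ q)
        (fun T q hT F' D' hF hD => hB Tᶜ q hT D' F' hD (by rwa [compl_compl]))
        (fun T q T' q' hT hT' hag => compl_injective (huniq _ q _ q' hT hT' fun f hf =>
          hag f (by simp only [Set.mem_compl_iff] at hf; tauto)))
        hp (ihD hc).compl h (fun hbad => (ihF hbad).compl)
      simpa using this.compl

end Bases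

/-! ### Moving an orientation along a cone. -/

section Reorientation

variable {α ι : Type*}

/-- The sign vector of a vertex of the cube. -/
def boolSign (O : α → Bool) : α → SignType := fun e => if O e then 1 else -1

lemma toVec_boolSign (O : α → Bool) (e : α) : toVec (boolSign O) e = if O e then 1 else -1 := by
  rw [toVec_apply, boolSign]
  split_ifs <;> simp

lemma toVec_boolSign_mem (O : α → Bool) (e : α) :
    toVec (boolSign O) e = 1 ∨ toVec (boolSign O) e = -1 := by
  rw [toVec_boolSign]
  split_ifs <;> simp

lemma toVec_boolSign_injective :
    Function.Injective (fun O : α → Bool => toVec (boolSign O)) := fun O O' h => by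
  funext e
  have := congrFun h e
  simp only [toVec_boolSign] at this
  cases hO : O e <;> cases hO' : O' e <;> first | rfl | norm_num [hO, hO'] at this

lemma exists_toVec_boolSign {p : α → ℝ} (hp : ∀ e, p e = 1 ∨ p e = -1) :
    ∃ O : α → Bool, toVec (boolSign O) = p := by
  classical
  refine ⟨fun e => decide (p e = 1), funext fun e => ?_⟩
  rw [toVec_boolSign]
  rcases hp e with h | h <;> norm_num [h]

/-- Every sign vector can be moved along the cone of an acyclic family to a sign vector in which
no `-d i` is contained. -/
lemma exists_reorientation [Finite α] [Fintype ι] {d : ι → α → SignType} (hd : AcyclicFamily d)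
    (O : α → Bool) : ∃ (O' : α → Bool) (k : α → ℝ), InCone d k ∧
      toVec (boolSign O') = toVec (boolSign O) + 2 • k ∧
      ∀ i, ¬ ∀ e, d i e ≠ 0 → d i e = - boolSign O' e := by
  classical
  -- A smaller element for `r` lies further along the cone. Irreflexivity is exactly acyclicity, and
  -- finiteness then gives well-foundedness.
  let r : (α → Bool) → (α → Bool) → Prop := fun O₂ O₁ => ∃ a : ι → ℝ, (∀ i, 0 ≤ a i) ∧ a ≠ 0 ∧
    ∀ e, toVec (boolSign O₂) e = toVec (boolSign O₁) e + 2 * ∑ i, a i * toVec (d i) e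
  have hwf : WellFounded r := by
    have : IsTrans _ r := ⟨fun O₃ O₂ O₁ ⟨b, hb, hb0, h'⟩ ⟨a, ha, ha0, h⟩ =>
      ⟨a + b, fun i => add_nonneg (ha i) (hb i), fun h0 => ha0 (funext fun i => by
        have := congrFun h0 i
        simp only [Pi.add_apply, Pi.zero_apply] at this ⊢
        linarith [ha i, hb i]), fun e => by
        rw [h', h]
        simp only [Pi.add_apply, add_mul, Finset.sum_add_distrib]
        ring⟩⟩
    have : Std.Irrefl r := ⟨fun O₁ ⟨a, ha, ha0, h⟩ => ha0 (funext (hd a ha fun e => by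
      linarith [h e]))⟩
    exact Finite.wellFounded_of_trans_of_irrefl r
  obtain ⟨O', ⟨k, hk, hO'⟩, hmin⟩ := hwf.has_min
    {O' | ∃ k, InCone d k ∧ toVec (boolSign O') = toVec (boolSign O) + 2 • k}
    ⟨O, 0, InCone.zero, by simp⟩
  refine ⟨O', k, hk, hO', fun i hi => ?_⟩
  -- If `-d i` were contained in `O'`, reversing it would add `2 • d i`, one more step along the
  -- cone.
  obtain ⟨O₂, hO₂⟩ := exists_toVec_boolSign (p := toVec (boolSign O') + 2 • toVec (d i)) fun e => by
    have h1 := toVec_boolSign_mem O' e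
    by_cases hde : d i e = 0
    · simpa [toVec_apply, hde] using h1
    · have h2 : toVec (d i) e = - toVec (boolSign O') e := by
        rw [toVec_apply, toVec_apply, hi e hde]
        simp
      simp only [Pi.add_apply, Pi.smul_apply, h2]
      rcases h1 with h | h <;> rw [h] <;> norm_num
  refine hmin O₂ ⟨k + toVec (d i), hk.add (inCone_single i), ?_⟩
    ⟨Pi.single i 1, fun j => ?_, by simp, fun e => ?_⟩
  · rw [hO₂, hO', smul_add, add_assoc]
  · by_cases h : j = i
    · subst h; simp
    · simp [h]
  · rw [hO₂]
    simp [Pi.single_apply]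

end Reorientation

/-! ### Splitting sign vectors into disjoint elementary ones, and summing them back. -/

section Decomposition

variable {α : Type*} [Finite α] {Z : Submodule ℝ (α → ℝ)} {Q : (α → SignType) → Prop}

/-- A sign vector of `Z` is a sum of elements of `Q` with disjoint supports, provided that each
nonzero sign vector of `Z` contains one. -/
lemma exists_disjoint_decomposition (hQ : ∀ R, Q R → toVec R ∈ Z)
    (hex : ∀ P : α → SignType, P ≠ 0 → toVec P ∈ Z → ∃ R, Q R ∧ R ≠ 0 ∧ ∀ e, R e ≠ 0 → R e = P e)
    (P : α → SignType) (hP : toVec P ∈ Z) : ∃ 𝒞 : Set (α → SignType),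
      (∀ R ∈ 𝒞, Q R ∧ ∀ e, R e ≠ 0 → R e = P e) ∧ 𝒞.PairwiseDisjoint Function.support ∧
      ⋃ R ∈ 𝒞, Function.support R = Function.support P := by
  classical
  induction hn : (Function.support P).ncard using Nat.strong_induction_on generalizing P with
  | _ n ih =>
    by_cases hP0 : P = 0
    · exact ⟨∅, by simp, by simp, by simp [hP0]⟩
    obtain ⟨R, hR, hR0, hRP⟩ := hex P hP0 hP
    -- Peeling `R` off `P` leaves a sign vector, equal to the difference, hence still in `Z`.
    set P' : α → SignType := fun e => if R e = 0 then P e else 0 with hP'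
    have hvec : toVec P' = toVec P - toVec R := by
      funext e
      simp only [toVec_apply, Pi.sub_apply, hP']
      split_ifs with h
      · simp [h]
      · simp [hRP e h]
    have hsub : Function.support P' ⊂ Function.support P := by
      refine ⟨fun e he => ?_, fun hsup => hR0 (funext fun e => ?_)⟩
      · simp only [hP', Function.mem_support, ne_eq, ite_eq_right_iff, Classical.not_imp] at he
        exact he.2
      · by_contra hne
        have h1 : e ∈ Function.support P := by
          rw [Function.mem_support, ← hRP e hne]; exact hne
        have h2 := hsup h1
        simp only [hP', Function.mem_support, ne_eq, ite_eq_right_iff, Classical.not_imp] at h2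
        exact hne h2.1
    obtain ⟨𝒞, h1, h2, h3⟩ := ih _ (hn ▸ Set.ncard_lt_ncard hsub) P'
      (hvec ▸ Z.sub_mem hP (hQ R hR)) rfl
    refine ⟨insert R 𝒞, ?_, ?_, ?_⟩
    · rintro R' (rfl | hR')
      · exact ⟨hR, hRP⟩
      · refine ⟨(h1 R' hR').1, fun e he => ?_⟩
        have h4 := (h1 R' hR').2 e he
        have h5 : R e = 0 := by
          by_contra hne
          rw [h4] at he
          simp [hP', hne] at he
        rw [h4]
        simp [hP', h5]
    · refine Set.pairwiseDisjoint_insert.2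
        ⟨h2, fun R' hR' _ => Set.disjoint_left.2 fun e he he' => ?_⟩
      have h4 := (h1 R' hR').2 e he'
      rw [Function.mem_support, h4] at he'
      simp only [hP', ne_eq, ite_eq_right_iff, Classical.not_imp] at he'
      exact he he'.1
    · rw [Set.biUnion_insert, h3]
      ext e
      simp only [Set.mem_union, Function.mem_support, hP', ne_eq, ite_eq_right_iff,
        Classical.not_imp]
      constructor
      · rintro (h | h)
        · rwa [← hRP e h]
        · exact h.2
      · intro h
        by_cases hRe : R e = 0
        · exact Or.inr ⟨hRe, h⟩
        · exact Or.inl hRe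

/-- The sum of sign vectors contained in `p` with disjoint supports. -/
lemma exists_sum_of_disjoint (p : α → SignType) (𝒞 : Set (α → SignType))
    (h𝒞 : ∀ R ∈ 𝒞, toVec R ∈ Z ∧ ∀ e, R e ≠ 0 → R e = p e)
    (hdisj : 𝒞.PairwiseDisjoint Function.support) : ∃ c ∈ Z,
      (∀ e ∈ ⋃ R ∈ 𝒞, Function.support R, c e = toVec p e) ∧
      ∀ e ∉ ⋃ R ∈ 𝒞, Function.support R, c e = 0 := by
  classical
  have hfin : 𝒞.Finite := Set.toFinite 𝒞
  refine ⟨∑ R ∈ hfin.toFinset, toVec R, Z.sum_mem fun R hR => (h𝒞 R (by simpa using hR)).1,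
    fun e he => ?_, fun e he => ?_⟩
  · simp only [Set.mem_iUnion, Function.mem_support] at he
    obtain ⟨R, hR, he⟩ := he
    rw [Finset.sum_apply, Finset.sum_eq_single R]
    · rw [toVec_apply, (h𝒞 R hR).2 e he, toVec_apply]
    · intro R' hR' hne
      rw [toVec_eq_zero_iff]
      by_contra h
      exact Set.disjoint_left.1 (hdisj (by simpa using hR') hR hne) h he
    · intro h
      exact absurd hR (by simpa using h)
  · rw [Finset.sum_apply]
    refine Finset.sum_eq_zero fun R hR => ?_
    rw [toVec_eq_zero_iff]
    by_contra h
    exact he (Set.mem_biUnion (by simpa using hR) h)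

end Decomposition

/-! ### Elementary vectors, signatures and compatible orientations. -/

section Elementary

variable {α ι κ : Type*}

/-- The sign vectors satisfying `Q` are elementary vectors of `Z` (they have minimal support), and
every nonzero vector of `Z` has one conformal to it. -/
structure IsElementary (Z : Submodule ℝ (α → ℝ)) (Q : (α → SignType) → Prop) : Prop where
  mem : ∀ P, Q P → toVec P ∈ Z
  ne_zero : ∀ P, Q P → P ≠ 0
  exists_conformal : ∀ v ∈ Z, v ≠ 0 → ∃ R, Q R ∧ ∀ e, R e ≠ 0 → R e = SignType.sign (v e)
  support_eq : ∀ P R, Q P → Q R → Function.support R ⊆ Function.support P →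
    Function.support R = Function.support P

/-- The family `d` contains exactly one elementary vector for each support. -/
structure IsSignature (Q : (α → SignType) → Prop) (d : ι → α → SignType) : Prop where
  elementary : ∀ i, Q (d i)
  exists_support_eq : ∀ P, Q P → ∃ i, Function.support (d i) = Function.support P
  injective : ∀ i j, Function.support (d i) = Function.support (d j) → i = j

/-- Every elementary vector contained in `O` belongs to the family `d`. -/
def CompatibleWith (Q : (α → SignType) → Prop) (d : ι → α → SignType) (O : α → Bool) : Prop :=
  ∀ P, Q P → (∀ e ∈ Function.support P, P e = boolSign O e) → P ∈ Set.range d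

lemma sign_toVec (P : α → SignType) (e : α) : SignType.sign (toVec P e) = P e := by
  rw [toVec_apply]
  generalize P e = s
  cases s <;> simp

lemma noBad_empty_iff {d : ι → α → SignType} {O : α → Bool} :
    NoBad d ∅ ∅ (toVec (boolSign O)) ↔ ∀ i, ¬ ∀ e, d i e ≠ 0 → d i e = -boolSign O e := by
  have key : ∀ s t : SignType, t ≠ 0 → (0 ≤ -(s : ℝ) * (t : ℝ) ↔ (s ≠ 0 → s = -t)) := by
    intro s t ht
    cases s <;> cases t <;> first | exact absurd rfl ht | norm_num [SignType.cast]
  refine forall_congr' fun i => ?_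
  simp only [Set.mem_empty_iff_false, IsEmpty.forall_iff, implies_true, not_false_eq_true,
    forall_const, toVec_apply]
  refine not_congr (forall_congr' fun e => key _ _ ?_)
  rw [boolSign]
  split_ifs <;> decide

variable {Z Z' : Submodule ℝ (α → ℝ)} {Q Q' : (α → SignType) → Prop}

/-- Otherwise `P` and `R` agree at some `e` of their support, and an elementary vector conformal to
the nonzero `P - R` would have smaller support, as it misses `e`. -/
lemma IsElementary.eq_or_eq_neg (hQ : IsElementary Z Q) {P R : α → SignType} (hP : Q P) (hR : Q R)
    (h : Function.support P = Function.support R) : P = R ∨ P = -R := by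
  by_contra! hcon
  obtain ⟨hne, hne'⟩ := hcon
  have hzero : ∀ e, P e = 0 ↔ R e = 0 := fun e => by
    rw [← not_iff_not]; exact Set.ext_iff.1 h e
  obtain ⟨e, he⟩ := Function.ne_iff.1 hne'
  have hee : P e = R e ∧ P e ≠ 0 := by
    have h1 := hzero e
    rw [Pi.neg_apply] at he
    revert h1 he
    generalize P e = s
    generalize R e = t
    revert s t
    decide
  obtain ⟨S, hS, hS'⟩ := hQ.exists_conformal (toVec P - toVec R)
    (Z.sub_mem (hQ.mem P hP) (hQ.mem R hR)) (sub_ne_zero.2 fun h => hne (toVec_injective h))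
  have hsupp := hQ.support_eq P S hP hS fun f hf => by
    intro hf0
    refine hf ?_
    by_contra hSf
    have h2 := hS' f hSf
    rw [Pi.sub_apply, toVec_apply, toVec_apply, (hzero f).1 hf0, hf0] at h2
    simp at h2
    exact hSf h2
  have h3 : e ∈ Function.support S := hsupp ▸ hee.2
  have h4 := hS' e h3
  rw [Pi.sub_apply, toVec_apply, toVec_apply, hee.1] at h4
  simp at h4
  exact h3 h4

lemma compatibleWith_iff {d : ι → α → SignType} (hQ : IsElementary Z Q) (hd : IsSignature Q d)
    {O : α → Bool} : CompatibleWith Q d O ↔ NoBad d ∅ ∅ (toVec (boolSign O)) := by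
  rw [noBad_empty_iff]
  constructor
  · intro h i hi
    -- That `-d i` satisfies `Q` is not assumed, so an elementary vector conformal to it takes its
    -- place. Compatibility then makes this vector `d i` itself, a contradiction.
    obtain ⟨R, hR, hR'⟩ := hQ.exists_conformal (-toVec (d i))
      (Z.neg_mem (hQ.mem _ (hd.elementary i))) fun h0 => hQ.ne_zero _ (hd.elementary i)
        (funext fun e => toVec_eq_zero_iff.1 (by simpa using congrFun h0 e))
    have hR2 : ∀ e, R e ≠ 0 → R e = - d i e := fun e he => by
      rw [hR' e he, Pi.neg_apply, Left.sign_neg, sign_toVec]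
    have hsub : Function.support R ⊆ Function.support (d i) := fun e he h0 => by
      have := hR2 e he
      rw [h0] at this
      exact he this
    obtain ⟨j, rfl⟩ := h R hR fun e he => by
      rw [hR2 e he, hi e (hsub he), neg_neg]
    have hij := hd.injective j i (hQ.support_eq _ _ (hd.elementary i) hR hsub)
    subst hij
    obtain ⟨e, he⟩ := Function.ne_iff.1 (hQ.ne_zero _ hR)
    have := hR2 e he
    revert this he
    simp only [Pi.zero_apply]
    generalize d j e = s
    revert s
    decide
  · intro h P hP hPO
    obtain ⟨i, hi⟩ := hd.exists_support_eq P hP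
    rcases hQ.eq_or_eq_neg (hd.elementary i) hP hi with h1 | h1
    · exact ⟨i, h1⟩
    · refine absurd (fun e he => ?_) (h i)
      rw [h1, Pi.neg_apply, hPO e (hi ▸ he)]

/-- The part of `O'` where it differs from `O`. -/
def diffPart (O O' : α → Bool) : α → SignType := fun e => if O e = O' e then 0 else boolSign O' e

lemma boolSign_ne_zero (O : α → Bool) (e : α) : boolSign O e ≠ 0 := by
  rw [boolSign]
  split_ifs <;> decide

lemma diffPart_ne_zero_iff {O O' : α → Bool} {e : α} : diffPart O O' e ≠ 0 ↔ O e ≠ O' e := by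
  have := boolSign_ne_zero O' e
  simp [diffPart, this]

lemma diffPart_of_ne_zero {O O' : α → Bool} {e : α} (h : diffPart O O' e ≠ 0) :
    diffPart O O' e = boolSign O' e := if_neg (diffPart_ne_zero_iff.1 h)

lemma two_smul_toVec_diffPart (O O' : α → Bool) :
    2 • toVec (diffPart O O') = toVec (boolSign O') - toVec (boolSign O) := by
  funext e
  simp only [Pi.smul_apply, Pi.sub_apply, toVec_apply, diffPart, boolSign]
  cases O e <;> cases O' e <;> norm_num

lemma toVec_diffPart_eq {O O' : α → Bool} {k : α → ℝ}
    (h : toVec (boolSign O') = toVec (boolSign O) + 2 • k) : toVec (diffPart O O') = k := by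
  funext e
  have h1 := congrFun (two_smul_toVec_diffPart O O') e
  have h2 := congrFun h e
  simp only [Pi.smul_apply, Pi.sub_apply, Pi.add_apply, nsmul_eq_mul, Nat.cast_ofNat,
    Pi.mul_apply, Pi.ofNat_apply] at h1 h2
  linarith

variable [Fintype α] [Fintype ι] [Fintype κ]
  {d : ι → α → SignType} {d' : κ → α → SignType}

/-- Every vertex of the cube arises from a compatible one by reversing disjoint elementary
vectors of both kinds. -/
lemma exists_compatible_reversal (horth : ∀ v ∈ Z, ∀ u ∈ Z', ∑ e, v e * u e = 0)
    (hQ : IsElementary Z Q) (hQ' : IsElementary Z' Q') (hd : IsSignature Q d)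
    (hd' : IsSignature Q' d') (hac : AcyclicFamily d) (hac' : AcyclicFamily d') (O : α → Bool) :
    ∃ (O' : α → Bool) (𝒞 𝒟 : Set (α → SignType)),
      CompatibleWith Q d O' ∧ CompatibleWith Q' d' O' ∧
      (∀ P ∈ 𝒞, Q P ∧ ∀ e, P e ≠ 0 → P e = boolSign O' e) ∧
      (∀ P ∈ 𝒟, Q' P ∧ ∀ e, P e ≠ 0 → P e = boolSign O' e) ∧
      𝒞.PairwiseDisjoint Function.support ∧ 𝒟.PairwiseDisjoint Function.support ∧
      Disjoint (⋃ P ∈ 𝒞, Function.support P) (⋃ P ∈ 𝒟, Function.support P) ∧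
      ∀ e, O e ≠ O' e ↔ e ∈ (⋃ P ∈ 𝒞, Function.support P) ∪ ⋃ P ∈ 𝒟, Function.support P := by
  classical
  obtain ⟨O₁, k, hk, hO₁, hbad⟩ := exists_reorientation hac O
  obtain ⟨O₂, k', hk', hO₂, hbad'⟩ := exists_reorientation hac' O₁
  rw [← noBad_empty_iff, ← compatibleWith_iff hQ hd] at hbad
  rw [← noBad_empty_iff, ← compatibleWith_iff hQ' hd'] at hbad'
  have hP : toVec (diffPart O O₁) ∈ Z := by
    rw [toVec_diffPart_eq hO₁]
    exact hk.mem fun i => hQ.mem _ (hd.elementary i)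
  have hP' : toVec (diffPart O₁ O₂) ∈ Z' := by
    rw [toVec_diffPart_eq hO₂]
    exact hk'.mem fun i => hQ'.mem _ (hd'.elementary i)
  have hneg : ∀ e, O₁ e ≠ O₂ e → boolSign O₁ e = - boolSign O₂ e := fun e he => by
    simp only [boolSign]
    cases h1 : O₁ e <;> cases h2 : O₂ e <;> simp_all
  -- An edge moved in both steps has opposite signs in the two difference vectors, so every product
  -- is nonpositive, and orthogonality kills each one.
  have hdisj : ∀ e, diffPart O O₁ e = 0 ∨ diffPart O₁ O₂ e = 0 := fun e => by
    have hle : ∀ e ∈ Finset.univ, toVec (diffPart O O₁) e * toVec (diffPart O₁ O₂) e ≤ 0 := by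
      intro e _
      by_cases h1 : diffPart O O₁ e = 0
      · simp [toVec_apply, h1]
      by_cases h2 : diffPart O₁ O₂ e = 0
      · simp [toVec_apply, h2]
      rw [toVec_apply, toVec_apply, diffPart_of_ne_zero h1, diffPart_of_ne_zero h2,
        hneg e (diffPart_ne_zero_iff.1 h2), SignType.coe_neg]
      nlinarith [mul_self_nonneg (boolSign O₂ e : ℝ)]
    have := (Finset.sum_eq_zero_iff_of_nonpos hle).1 (horth _ hP _ hP') e (Finset.mem_univ e)
    simpa [toVec_eq_zero_iff] using mul_eq_zero.1 this
  -- The second step preserves compatibility of the first kind: an elementary vector in `O₂` is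
  -- disjoint from the part changed, again by orthogonality, so it was already in `O₁`.
  have hcompat : CompatibleWith Q d O₂ := fun R hR hRO => by
    refine hbad R hR fun e he => ?_
    have hge : ∀ e ∈ Finset.univ, 0 ≤ toVec R e * toVec (diffPart O₁ O₂) e := by
      intro e _
      by_cases h1 : R e = 0
      · simp [toVec_apply, h1]
      by_cases h2 : diffPart O₁ O₂ e = 0
      · simp [toVec_apply, h2]
      rw [toVec_apply, toVec_apply, diffPart_of_ne_zero h2, hRO e h1]
      exact mul_self_nonneg _
    have := (Finset.sum_eq_zero_iff_of_nonneg hge).1 (horth _ (hQ.mem R hR) _ hP') e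
      (Finset.mem_univ e)
    have h2 : diffPart O₁ O₂ e = 0 := by
      rw [mul_eq_zero, toVec_eq_zero_iff, toVec_eq_zero_iff] at this
      exact this.resolve_left he
    have h3 : O₁ e = O₂ e := by
      by_contra h
      exact diffPart_ne_zero_iff.2 h h2
    rw [hRO e he, boolSign, boolSign, h3]
  obtain ⟨𝒞, h𝒞, h𝒞d, h𝒞u⟩ := exists_disjoint_decomposition (Z := Z) (Q := Q) hQ.mem
    (fun P hP0 hPZ => by
      obtain ⟨R, hR, hR'⟩ := hQ.exists_conformal _ hPZ fun h0 => hP0 (funext fun e =>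
        toVec_eq_zero_iff.1 (congrFun h0 e))
      exact ⟨R, hR, hQ.ne_zero R hR, fun e he => by rw [hR' e he, sign_toVec]⟩) _ hP
  obtain ⟨𝒟, h𝒟, h𝒟d, h𝒟u⟩ := exists_disjoint_decomposition (Z := Z') (Q := Q') hQ'.mem
    (fun P hP0 hPZ => by
      obtain ⟨R, hR, hR'⟩ := hQ'.exists_conformal _ hPZ fun h0 => hP0 (funext fun e =>
        toVec_eq_zero_iff.1 (congrFun h0 e))
      exact ⟨R, hR, hQ'.ne_zero R hR, fun e he => by rw [hR' e he, sign_toVec]⟩) _ hP'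
  refine ⟨O₂, 𝒞, 𝒟, hcompat, hbad', fun P hPC => ⟨(h𝒞 P hPC).1, fun e he => ?_⟩,
    fun P hPD => ⟨(h𝒟 P hPD).1, fun e he => ?_⟩, h𝒞d, h𝒟d, ?_, fun e => ?_⟩
  · have h1 := (h𝒞 P hPC).2 e he
    have h2 : diffPart O O₁ e ≠ 0 := h1 ▸ he
    have h3 : O₁ e = O₂ e := by
      by_contra h
      exact diffPart_ne_zero_iff.2 h ((hdisj e).resolve_left h2)
    rw [h1, diffPart_of_ne_zero h2, boolSign, boolSign, h3]
  · have h1 := (h𝒟 P hPD).2 e he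
    rw [h1, diffPart_of_ne_zero (h1 ▸ he)]
  · rw [h𝒞u, h𝒟u, Set.disjoint_left]
    exact fun e h1 h2 => (hdisj e).elim h1 h2
  · rw [h𝒞u, h𝒟u, Set.mem_union, Function.mem_support, Function.mem_support]
    have h1 := hdisj e
    rw [diffPart_ne_zero_iff, diffPart_ne_zero_iff]
    rw [← not_ne_iff, ← not_ne_iff, diffPart_ne_zero_iff, diffPart_ne_zero_iff] at h1
    revert h1
    cases O e <;> cases O₁ e <;> cases O₂ e <;> simp

end Elementary

/-! ### Flow space and cut space: directed cycles and cocycles are elementary. -/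

section GraphSpaces

variable {V E : Type*} {G : Graph V E}

/-- The potential difference along the edges. -/
def potentialDiff (R : ReferenceOrientation G) : (V → ℝ) →ₗ[ℝ] (E(G) → ℝ) where
  toFun φ e := φ (R.head e) - φ (R.tail e)
  map_add' φ ψ := by funext e; simp only [Pi.add_apply]; ring
  map_smul' t φ := by funext e; simp only [Pi.smul_apply, smul_eq_mul, RingHom.id_apply]; ring

lemma potentialDiff_apply (R : ReferenceOrientation G) (φ : V → ℝ) (e : E(G)) :
    potentialDiff R φ e = φ (R.head e) - φ (R.tail e) := rfl

/-- The cut space. -/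
def cutSpace (R : ReferenceOrientation G) : Submodule ℝ (E(G) → ℝ) :=
  LinearMap.range (potentialDiff R)

/-- The vector `w` is a flow from `x` to `y` of value one. -/
def IsUnitFlow [Fintype E(G)] (R : ReferenceOrientation G) (w : E(G) → ℝ) (x y : V) : Prop :=
  ∀ φ : V → ℝ, ∑ e, w e * potentialDiff R φ e = φ y - φ x

/-- The flow space, which is the orthogonal complement of the cut space. -/
def flowSpace [Fintype E(G)] (R : ReferenceOrientation G) : Submodule ℝ (E(G) → ℝ) where
  carrier := {v | ∀ φ : V → ℝ, ∑ e, v e * potentialDiff R φ e = 0}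
  add_mem' {v w} hv hw φ := by
    simp only [Pi.add_apply, add_mul, Finset.sum_add_distrib]
    rw [hv φ, hw φ, add_zero]
  zero_mem' φ := by simp
  smul_mem' t v hv φ := by
    simp only [Pi.smul_apply, smul_eq_mul, mul_assoc, ← Finset.mul_sum]
    rw [hv φ, mul_zero]

lemma mem_cut_iff (R : ReferenceOrientation G) {W : Set V} {e : E(G)} :
    e ∈ cut G W ↔ ¬ (R.tail e ∈ W ↔ R.head e ∈ W) := by
  constructor
  · rintro ⟨x, hx, y, hy, h⟩
    rcases (R.isLink e).eq_and_eq_or_eq_and_eq h with ⟨h1, h2⟩ | ⟨h1, h2⟩ <;>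
      rw [h1, h2] <;> tauto
  · intro h
    by_cases ht : R.tail e ∈ W
    · exact ⟨_, ht, _, fun hh => h (iff_of_true ht hh), R.isLink e⟩
    · refine ⟨R.head e, ?_, _, ht, (R.isLink e).symm⟩
      by_contra hh
      exact h (iff_of_false ht hh)

lemma IsArc.isLink {R : ReferenceOrientation G} {e : E(G)} {s : SignType} {x y : V}
    (h : IsArc R e s x y) : G.IsLink (e : E) x y := by
  rcases h with ⟨-, rfl, rfl⟩ | ⟨-, rfl, rfl⟩
  · exact R.isLink e
  · exact (R.isLink e).symm

lemma IsArc.coe_mul {R : ReferenceOrientation G} {e : E(G)} {s : SignType} {x y : V}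
    (h : IsArc R e s x y) (φ : V → ℝ) : (s : ℝ) * potentialDiff R φ e = φ y - φ x := by
  rcases h with ⟨rfl, rfl, rfl⟩ | ⟨rfl, rfl, rfl⟩ <;> simp [potentialDiff_apply]

lemma IsArc.left_unique {R : ReferenceOrientation G} {e : E(G)} {s : SignType} {x y x' y' : V}
    (h : IsArc R e s x y) (h' : IsArc R e s x' y') : x = x' := by
  rcases h with ⟨rfl, rfl, rfl⟩ | ⟨rfl, rfl, rfl⟩ <;> rcases h' with ⟨h, rfl, rfl⟩ | ⟨h, rfl, rfl⟩
  · rfl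
  · exact absurd h (by decide)
  · exact absurd h (by decide)
  · rfl

lemma IsArc.ne_zero {R : ReferenceOrientation G} {e : E(G)} {s : SignType} {x y : V}
    (h : IsArc R e s x y) : s ≠ 0 := by
  rcases h with ⟨rfl, -⟩ | ⟨rfl, -⟩ <;> decide

lemma exists_isArc_of_isLink (R : ReferenceOrientation G) {e : E(G)} {x y : V}
    (h : G.IsLink (e : E) x y) : ∃ s, IsArc R e s x y := by
  rcases (R.isLink e).eq_and_eq_or_eq_and_eq h with ⟨h1, h2⟩ | ⟨h1, h2⟩
  · exact ⟨1, Or.inl ⟨rfl, h1, h2⟩⟩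
  · exact ⟨-1, Or.inr ⟨rfl, h2, h1⟩⟩

lemma IsDirectedCycle.isCycle {R : ReferenceOrientation G} {P : PartialOrientation G}
    (h : IsDirectedCycle R P) : IsCycle G (Function.support P) := by
  obtain ⟨n, v, c, hv, hc, harc, hP⟩ := h
  exact ⟨n, v, c, hv, hc, fun i => (harc i).isLink, hP⟩

lemma IsDirectedCocycle.isCocycle {R : ReferenceOrientation G} {P : PartialOrientation G}
    (h : IsDirectedCocycle R P) : IsCocycle G (Function.support P) := by
  obtain ⟨W, hW, hP, -⟩ := h
  exact hP ▸ hW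

lemma IsDirectedCycle.ne_zero {R : ReferenceOrientation G} {P : PartialOrientation G}
    (h : IsDirectedCycle R P) : P ≠ 0 := by
  obtain ⟨n, v, c, -, -, harc, -⟩ := h
  exact fun h0 => (harc 0).ne_zero (by rw [h0]; rfl)

lemma IsDirectedCocycle.ne_zero {R : ReferenceOrientation G} {P : PartialOrientation G}
    (h : IsDirectedCocycle R P) : P ≠ 0 := by
  rintro rfl
  have := h.isCocycle.prop.1
  simp at this

lemma IsDirectedCocycle.mem_cutSpace {R : ReferenceOrientation G} {P : PartialOrientation G}
    (h : IsDirectedCocycle R P) : toVec P ∈ cutSpace R := by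
  classical
  obtain ⟨W, -, hP, harc⟩ := h
  refine ⟨fun x => if x ∈ W then 0 else 1, funext fun e => ?_⟩
  rw [potentialDiff_apply]
  by_cases he : e ∈ cut G W
  · obtain ⟨x, hx, y, hy, h⟩ := harc e he
    rw [toVec_apply]
    rcases h with ⟨h, rfl, rfl⟩ | ⟨h, rfl, rfl⟩ <;> simp [h, hx, hy]
  · have h0 : P e = 0 := by rwa [← hP, Function.mem_support, not_not] at he
    rw [mem_cut_iff R, not_not] at he
    by_cases ht : R.tail e ∈ W
    · simp [ht, he.1 ht, toVec_apply, h0]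
    · simp [ht, mt he.2 ht, toVec_apply, h0]

section Flow

variable [Fintype E(G)] {R : ReferenceOrientation G}

lemma flow_cut_orthogonal : ∀ v ∈ flowSpace R, ∀ u ∈ cutSpace R, ∑ e, v e * u e = 0 := by
  rintro v hv _ ⟨φ, rfl⟩
  exact hv φ

lemma IsUnitFlow.zero (x : V) : IsUnitFlow R 0 x x := fun φ => by simp

lemma IsUnitFlow.add {w w' : E(G) → ℝ} {x y z : V} (h : IsUnitFlow R w x y)
    (h' : IsUnitFlow R w' y z) : IsUnitFlow R (w + w') x z := fun φ => by
  simp only [Pi.add_apply, add_mul, Finset.sum_add_distrib]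
  rw [h φ, h' φ]
  ring

lemma IsUnitFlow.mem_flowSpace {w : E(G) → ℝ} {x : V} (h : IsUnitFlow R w x x) :
    w ∈ flowSpace R := fun φ => by rw [h φ, sub_self]

open Classical in
lemma IsArc.isUnitFlow {e : E(G)} {s : SignType} {x y : V} (h : IsArc R e s x y) :
    IsUnitFlow R (Pi.single e (s : ℝ)) x y := fun φ => by
  rw [Finset.sum_eq_single e (fun f _ hf => by simp [hf]) (by simp), Pi.single_eq_same, h.coe_mul]

lemma sum_of_support_subset_range {n : ℕ} {c : Fin (n + 1) → E(G)} (hc : Function.Injective c)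
    {f : E(G) → ℝ} (hf : ∀ e ∉ Set.range c, f e = 0) : ∑ e, f e = ∑ i, f (c i) := by
  classical
  rw [← Finset.sum_image (s := Finset.univ) (g := c) (f := f) fun i _ j _ h => hc h]
  refine (Finset.sum_subset (Finset.subset_univ _) fun e _ he => hf e ?_).symm
  simpa using he

lemma IsDirectedCycle.mem_flowSpace {P : PartialOrientation G} (h : IsDirectedCycle R P) :
    toVec P ∈ flowSpace R := fun φ => by
  obtain ⟨n, v, c, -, hc, harc, hP⟩ := h
  rw [sum_of_support_subset_range hc fun e he => by
    rw [← hP, Function.mem_support, not_not] at he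
    simp [toVec_apply, he]]
  simp only [toVec_apply, (harc _).coe_mul, Finset.sum_sub_distrib]
  rw [sub_eq_zero]
  exact Equiv.sum_comp (Equiv.addRight (1 : Fin (n + 1))) fun i => φ (v i)

lemma IsDirectedCycle.eq_smul {P : PartialOrientation G} (h : IsDirectedCycle R P)
    {w : E(G) → ℝ} (hw : w ∈ flowSpace R) (hsupp : ∀ e, P e = 0 → w e = 0) :
    ∃ t : ℝ, w = t • toVec P := by
  classical
  obtain ⟨n, v, c, hv, hc, harc, hP⟩ := h
  have hsq : ∀ i, (P (c i) : ℝ) * P (c i) = 1 := fun i => by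
    have := (harc i).ne_zero
    revert this
    generalize P (c i) = s
    cases s <;> simp
  set t : Fin (n + 1) → ℝ := fun i => w (c i) * P (c i) with ht
  have hwt : ∀ i, w (c i) = t i * P (c i) := fun i => by
    rw [ht]; dsimp only
    rw [mul_assoc, hsq, mul_one]
  -- Conservation at the vertex `v (i + 1)`, tested with its indicator function.
  have hstep : ∀ i, t (i + 1) = t i := fun i => by
    have h0 := hw (fun x => if x = v (i + 1) then 1 else 0)
    rw [sum_of_support_subset_range hc fun e he => by
      rw [← hP, Function.mem_support, not_not] at he
      simp [hsupp e he]] at h0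
    simp only [hwt, mul_assoc, (harc _).coe_mul, hv.eq_iff, mul_sub, Finset.sum_sub_distrib,
      add_left_inj, mul_ite, mul_one, mul_zero, Finset.sum_ite_eq', Finset.mem_univ, if_true] at h0
    linarith
  have hconst : ∀ i, t i = t 0 := fun i => by
    induction i using Fin.induction with
    | zero => rfl
    | succ i ih => rw [← ih, ← hstep i.castSucc, Fin.coeSucc_eq_succ]
  refine ⟨t 0, funext fun e => ?_⟩
  rw [Pi.smul_apply, smul_eq_mul, toVec_apply]
  by_cases he : e ∈ Set.range c
  · obtain ⟨i, rfl⟩ := he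
    rw [hwt, hconst]
  · rw [← hP, Function.mem_support, not_not] at he
    simp [he, hsupp e he]

/-- Conservation at `y`: if no arc left `y`, every term tested against the indicator of `y` would be
nonnegative, hence zero. The given arc into `y` would then be a loop, which does leave `y`. -/
lemma exists_isArc_from (v : E(G) → ℝ) (hv : v ∈ flowSpace R) {e : E(G)} {x y : V}
    (h : IsArc R e (SignType.sign (v e)) x y) :
    ∃ f z, IsArc R f (SignType.sign (v f)) y z := by
  classical
  by_contra! hcon
  have h0 := hv (fun z => if z = y then 1 else 0)
  have hle : ∀ f ∈ Finset.univ,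
      0 ≤ v f * potentialDiff R (fun z => if z = y then 1 else 0) f := fun f _ => by
    rw [potentialDiff_apply]
    rcases lt_trichotomy (v f) 0 with hf | hf | hf
    · have : R.head f ≠ y := fun hy => hcon f (R.tail f) (Or.inr ⟨sign_neg hf, hy, rfl⟩)
      rw [if_neg this]
      split_ifs <;> simp [hf.le]
    · simp [hf]
    · have : R.tail f ≠ y := fun hy => hcon f (R.head f) (Or.inl ⟨sign_pos hf, hy, rfl⟩)
      rw [if_neg this]
      split_ifs <;> simp [hf.le]
  have he := (Finset.sum_eq_zero_iff_of_nonneg hle).1 h0 e (Finset.mem_univ e)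
  have hve : v e ≠ 0 := fun h1 => h.ne_zero (by simp [h1])
  rw [mul_eq_zero, or_iff_right hve] at he
  have h1 := h.coe_mul (fun z => if z = y then 1 else 0)
  rw [he, mul_zero, if_pos rfl] at h1
  split_ifs at h1 with hxy
  · subst hxy
    exact hcon e x h
  · norm_num at h1

/-- A nonzero flow contains a directed cycle. -/
lemma exists_isDirectedCycle (hV : V(G).Finite) (v : E(G) → ℝ) (hv : v ∈ flowSpace R)
    (hv0 : v ≠ 0) : ∃ P, IsDirectedCycle R P ∧ ∀ e, P e ≠ 0 → P e = SignType.sign (v e) := by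
  classical
  obtain ⟨e₀, he₀⟩ := Function.ne_iff.1 hv0
  let X := {y : V // ∃ e x, IsArc R e (SignType.sign (v e)) x y}
  have hnext : ∀ y : X, ∃ f, ∃ z : X, IsArc R f (SignType.sign (v f)) y z := fun ⟨y, e, x, h⟩ => by
    obtain ⟨f, z, hf⟩ := exists_isArc_from v hv h
    exact ⟨f, ⟨z, f, y, hf⟩, hf⟩
  choose nxtE nxt hnxt using hnext
  obtain ⟨x₀⟩ : Nonempty X := by
    rcases lt_or_gt_of_ne he₀ with h | h
    · exact ⟨R.tail e₀, e₀, R.head e₀, Or.inr ⟨sign_neg h, rfl, rfl⟩⟩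
    · exact ⟨R.head e₀, e₀, R.tail e₀, Or.inl ⟨sign_pos h, rfl, rfl⟩⟩
  have : Finite X := by
    refine Set.Finite.to_subtype (hV.subset ?_)
    rintro y ⟨e, x, h⟩
    exact h.isLink.right_mem
  let a : ℕ → X := fun n => nxt^[n] x₀
  have ha : ∀ n, a (n + 1) = nxt (a n) := fun n => Function.iterate_succ_apply' _ _ _
  -- The walk returns after `n + 1` steps; taking `n` least over all starting points makes the
  -- vertices in between distinct.
  have hex : ∃ n i, a i = a (i + n + 1) := by
    obtain ⟨i, j, hij, h⟩ := Finite.exists_ne_map_eq_of_infinite a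
    rcases lt_or_gt_of_ne hij with hlt | hlt
    · exact ⟨j - i - 1, i, by rw [h]; congr 1; omega⟩
    · exact ⟨i - j - 1, j, by rw [← h]; congr 1; omega⟩
  obtain ⟨i, hi⟩ := Nat.find_spec hex
  have hmin := fun m hm => Nat.find_min (H := hex) (m := m) hm
  generalize Nat.find hex = n at hi hmin
  have hinj : Function.Injective fun k : Fin (n + 1) => ((a (i + k) : X) : V) := by
    intro k l hkl
    have hkl := Subtype.ext hkl
    by_contra hne
    rcases lt_or_gt_of_ne hne with hlt | hlt
    · refine hmin (l - k - 1) (by omega) ⟨i + k, ?_⟩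
      rw [hkl]; congr 1; omega
    · refine hmin (k - l - 1) (by omega) ⟨i + l, ?_⟩
      rw [← hkl]; congr 1; omega
  let c : Fin (n + 1) → E(G) := fun k => nxtE (a (i + k))
  have harc : ∀ k : Fin (n + 1), IsArc R (c k) (SignType.sign (v (c k))) (a (i + k))
      (a (i + ((k + 1 : Fin (n + 1)) : ℕ))) := fun k => by
    have h1 := hnxt (a (i + k))
    rw [← ha] at h1
    rw [Fin.val_add_one]
    split_ifs with hk
    · subst hk
      rw [add_zero, hi]
      exact h1
    · exact h1
  have hP : ∀ e, (if e ∈ Set.range c then SignType.sign (v e) else 0) ≠ 0 ↔ e ∈ Set.range c := by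
    intro e
    refine ⟨fun h => by by_contra h'; exact h (if_neg h'), fun h => ?_⟩
    rw [if_pos h]
    obtain ⟨k, rfl⟩ := h
    exact (harc k).ne_zero
  refine ⟨fun e => if e ∈ Set.range c then SignType.sign (v e) else 0,
    ⟨n, _, c, hinj, fun k l hkl => hinj ?_, fun k => ?_, Set.ext hP⟩, fun e he => ?_⟩
  · have h1 := harc k
    rw [hkl] at h1
    exact h1.left_unique (harc l)
  · beta_reduce
    rw [if_pos ⟨k, rfl⟩]
    exact harc k
  · exact if_pos ((hP e).1 he)

lemma isElementary_directedCycle (hV : V(G).Finite) :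
    IsElementary (flowSpace R) (IsDirectedCycle R) where
  mem _ hP := hP.mem_flowSpace
  ne_zero _ hP := hP.ne_zero
  exists_conformal v hv hv0 := exists_isDirectedCycle hV v hv hv0
  support_eq P S hP hS h := by
    obtain ⟨t, ht⟩ := hP.eq_smul hS.mem_flowSpace fun e he => by
      rw [toVec_eq_zero_iff]
      by_contra hne
      exact h hne he
    refine h.antisymm fun e he he' => ?_
    have h1 := congrFun ht e
    rw [Pi.smul_apply, smul_eq_mul, toVec_eq_zero_iff.2 he', eq_comm, mul_eq_zero,
      toVec_eq_zero_iff, or_iff_left he] at h1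
    refine hS.ne_zero (funext fun f => toVec_eq_zero_iff.1 ?_)
    rw [ht, h1]
    simp

end Flow

/-- The edges leave `W` in the direction of `u`. -/
def IsOutCut (R : ReferenceOrientation G) (u : E(G) → ℝ) (W : Set V) : Prop :=
  ∀ e, (R.tail e ∈ W → R.head e ∉ W → 0 < u e) ∧ (R.tail e ∉ W → R.head e ∈ W → u e < 0)

/-- A nonempty directed cut contained in `u` and minimal with this property is a cocycle. -/
lemma isCocycle_of_minimal [Finite E(G)] {R : ReferenceOrientation G} {u : E(G) → ℝ} {W : Set V}
    (hW : IsOutCut R u W) (hne : (cut G W).Nonempty)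
    (hmin : ∀ X, IsOutCut R u X → (cut G X).Nonempty →
      (cut G W : Set E(G)).ncard ≤ (cut G X : Set E(G)).ncard) :
    IsCocycle G (cut G W) := by
  refine ⟨⟨hne, W, rfl⟩, ?_⟩
  rintro _ ⟨⟨f, hf⟩, W', rfl⟩ hsub
  have hsub' : ∀ e : E(G), ¬ (R.tail e ∈ W' ↔ R.head e ∈ W') →
      ¬ (R.tail e ∈ W ↔ R.head e ∈ W) := fun e he =>
    (mem_cut_iff R).1 (hsub ((mem_cut_iff R).2 he))
  have key : ∀ X : Set V, IsOutCut R u X → cut G X ⊆ cut G W → f ∈ cut G X →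
      cut G W ⊆ cut G X := fun X hX hXW hfX =>
    (Set.eq_of_subset_of_ncard_le hXW (hmin X hX ⟨f, hfX⟩) (Set.toFinite _)).ge
  have key' : ∀ X : Set V, (∀ e : E(G),
      (R.tail e ∈ X → R.head e ∉ X → R.tail e ∈ W ∧ R.head e ∉ W) ∧
      (R.tail e ∉ X → R.head e ∈ X → R.tail e ∉ W ∧ R.head e ∈ W)) → f ∈ cut G X →
      cut G W ⊆ cut G X := fun X hX hfX => by
    refine key X (fun e => ⟨fun h1 h2 => ?_, fun h1 h2 => ?_⟩) (fun e he => ?_) hfX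
    · obtain ⟨h3, h4⟩ := (hX e).1 h1 h2
      exact (hW e).1 h3 h4
    · obtain ⟨h3, h4⟩ := (hX e).2 h1 h2
      exact (hW e).2 h3 h4
    · rw [mem_cut_iff R] at he ⊢
      have := hX e
      tauto
  -- Uncrossing: as the cut of `W'` lies in that of `W`, these four sets are again directed like
  -- `W`. The edge `f` crosses both the first and second, or both the third and fourth. By
  -- minimality so does `e`, and hence `e` crosses `W'`.
  have h1 := key' (W ∩ W') fun e => by
    have := hsub' e
    simp only [Set.mem_inter_iff]; tauto
  have h2 := key' (W ∪ W') fun e => by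
    have := hsub' e
    simp only [Set.mem_union]; tauto
  have h3 := key' (W \ W') fun e => by
    have := hsub' e
    simp only [Set.mem_sdiff]; tauto
  have h4 := key' (W' \ W)ᶜ fun e => by
    have := hsub' e
    simp only [Set.mem_sdiff, Set.mem_compl_iff]; tauto
  intro e he
  have hfW := hsub hf
  have h5 := fun h => h1 h he
  have h6 := fun h => h2 h he
  have h7 := fun h => h3 h he
  have h8 := fun h => h4 h he
  rw [mem_cut_iff R] at *
  simp only [mem_cut_iff R, Set.mem_inter_iff, Set.mem_union, Set.mem_sdiff,
    Set.mem_compl_iff] at h5 h6 h7 h8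
  clear h1 h2 h3 h4 key key' hmin hsub hsub'
  generalize (R.tail e ∈ W) = p1 at *
  generalize (R.tail e ∈ W') = p2 at *
  generalize (R.head e ∈ W) = p3 at *
  generalize (R.head e ∈ W') = p4 at *
  generalize (R.tail f ∈ W) = p5 at *
  generalize (R.tail f ∈ W') = p6 at *
  generalize (R.head f ∈ W) = p7 at *
  generalize (R.head f ∈ W') = p8 at *
  by_cases p1 <;> by_cases p2 <;> by_cases p3 <;> by_cases p4 <;> simp_all
  all_goals by_cases p5 <;> by_cases p6 <;> by_cases p7 <;> simp_all

/-- A nonzero vector of the cut space contains a directed cocycle. -/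
lemma exists_isDirectedCocycle [Finite E(G)] {R : ReferenceOrientation G} (u : E(G) → ℝ)
    (hu : u ∈ cutSpace R) (hu0 : u ≠ 0) :
    ∃ P, IsDirectedCocycle R P ∧ ∀ e, P e ≠ 0 → P e = SignType.sign (u e) := by
  classical
  obtain ⟨φ, rfl⟩ := hu
  obtain ⟨f, hf⟩ := Function.ne_iff.1 hu0
  have hex : ∃ W : Set V, IsOutCut R (potentialDiff R φ) W ∧ (cut G W).Nonempty := by
    -- The potential increases along any exit from a sublevel set; this level separates the ends of
    -- `f`.
    refine ⟨{x | φ x ≤ min (φ (R.tail f)) (φ (R.head f))}, fun e => ⟨fun h1 h2 => ?_,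
      fun h1 h2 => ?_⟩, f, (mem_cut_iff R).2 ?_⟩
    · simp only [Set.mem_ofPred_eq, not_le] at h1 h2
      rw [potentialDiff_apply]
      linarith
    · simp only [Set.mem_ofPred_eq, not_le] at h1 h2
      rw [potentialDiff_apply]
      linarith
    · rw [potentialDiff_apply, Pi.zero_apply, sub_ne_zero] at hf
      simp only [Set.mem_ofPred_eq, le_min_iff, le_refl, true_and, and_true]
      exact fun h => by
        rcases lt_or_gt_of_ne hf with h1 | h1
        · exact absurd (h.2 h1.le) (not_le.2 h1)
        · exact absurd (h.1 h1.le) (not_le.2 h1)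
  obtain ⟨W, ⟨hW, hne⟩, hmin⟩ := (measure fun W : Set V =>
    (cut G W : Set E(G)).ncard).wf.has_min
      {W | IsOutCut R (potentialDiff R φ) W ∧ (cut G W).Nonempty} hex
  have hcoc := isCocycle_of_minimal hW hne fun X hX hX' => not_lt.1 (hmin X ⟨hX, hX'⟩)
  have harc : ∀ e ∈ cut G W, ∃ x ∈ W, ∃ y ∉ W,
      IsArc R e (SignType.sign (potentialDiff R φ e)) x y := fun e he => by
    rw [mem_cut_iff R] at he
    by_cases ht : R.tail e ∈ W
    · have hh : R.head e ∉ W := fun hh => he (iff_of_true ht hh)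
      exact ⟨_, ht, _, hh, Or.inl ⟨sign_pos ((hW e).1 ht hh), rfl, rfl⟩⟩
    · have hh : R.head e ∈ W := by
        by_contra hh
        exact he (iff_of_false ht hh)
      exact ⟨_, hh, _, ht, Or.inr ⟨sign_neg ((hW e).2 ht hh), rfl, rfl⟩⟩
  have hP : ∀ e, (if e ∈ cut G W then SignType.sign (potentialDiff R φ e) else 0) ≠ 0
      ↔ e ∈ cut G W := fun e => by
    refine ⟨fun h => by by_contra h'; exact h (if_neg h'), fun h => ?_⟩
    rw [if_pos h]
    obtain ⟨x, -, y, -, h⟩ := harc e h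
    exact h.ne_zero
  refine ⟨fun e => if e ∈ cut G W then SignType.sign (potentialDiff R φ e) else 0,
    ⟨W, hcoc, Set.ext hP, fun e he => ?_⟩, fun e he => if_pos ((hP e).1 he)⟩
  beta_reduce
  rw [if_pos he]
  exact harc e he

lemma isElementary_directedCocycle [Finite E(G)] (R : ReferenceOrientation G) :
    IsElementary (cutSpace R) (IsDirectedCocycle R) where
  mem _ hP := hP.mem_cutSpace
  ne_zero _ hP := hP.ne_zero
  exists_conformal v hv hv0 := exists_isDirectedCocycle v hv hv0
  support_eq _ _ hP hS h := h.antisymm (hP.isCocycle.le_of_le hS.isCocycle.prop h)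

end GraphSpaces

/-! ### Painting lemma, fundamental cycles and cocycles, spanning trees. -/

section SpanningTrees

variable {V E : Type*} {G : Graph V E} [Fintype E(G)] {R : ReferenceOrientation G}

/-- Minty's painting lemma for flows and cuts. -/
lemma paintingProperty (R : ReferenceOrientation G) :
    PaintingProperty (flowSpace R) (cutSpace R) := by
  classical
  intro A B s hAB hs e₀ he₀
  let Good : (E(G) → ℝ) → Prop := fun w => (∀ e ∉ A ∪ B, w e = 0) ∧ ∀ e ∈ B, 0 ≤ w e * s e
  have hgood_add : ∀ w w', Good w → Good w' → Good (w + w') := fun w w' h h' =>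
    ⟨fun e he => by simp [h.1 e he, h'.1 e he], fun e he => by
      rw [Pi.add_apply, add_mul]; exact add_nonneg (h.2 e he) (h'.2 e he)⟩
  have hgoodA : ∀ e ∈ A, ∀ t : ℝ, Good (Pi.single e t) := fun e he t =>
    ⟨fun f hf => by
      have : f ≠ e := fun h => hf (Or.inl (h ▸ he))
      simp [this], fun f hf => by
      have : f ≠ e := fun h => Set.disjoint_left.1 hAB he (h ▸ hf)
      simp [this]⟩
  have hgoodB : ∀ e ∈ B, Good (Pi.single e (s e)) := fun e he =>
    ⟨fun f hf => by
      have : f ≠ e := fun h => hf (Or.inr (h ▸ he))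
      simp [this], fun f hf => by
      by_cases h : f = e
      · subst h
        rw [Pi.single_eq_same]
        exact mul_self_nonneg _
      · simp [h]⟩
  have harc : ∀ e, ∃ x y, IsArc R e (SignType.sign (s e)) x y := fun e => by
    rcases hs e with h | h <;> rw [h]
    · exact ⟨_, _, Or.inl ⟨by simp, rfl, rfl⟩⟩
    · exact ⟨_, _, Or.inr ⟨by simp, rfl, rfl⟩⟩
  have hsign : ∀ e, ((SignType.sign (s e) : SignType) : ℝ) = s e := fun e => by
    rcases hs e with h | h <;> rw [h] <;> simp
  obtain ⟨x, y, hxy⟩ := harc e₀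
  -- Vertices reachable from the head `y` of `e₀` by admissible flows. If the tail `x` is reached,
  -- closing up with `e₀` gives the flow; otherwise no edge of `A` crosses `W` and edges of `B` only
  -- enter it, which gives the cut vector.
  let W : Set V := {b | ∃ w, Good w ∧ IsUnitFlow R w y b}
  have hstep : ∀ e b c t, IsArc R e t b c → Good (Pi.single e (t : ℝ)) → b ∈ W → c ∈ W := by
    rintro e b c t h hg ⟨w, hw, hw'⟩
    exact ⟨w + Pi.single e (t : ℝ), hgood_add _ _ hw hg, hw'.add h.isUnitFlow⟩
  have hyW : y ∈ W := ⟨0, ⟨by simp, by simp⟩, IsUnitFlow.zero y⟩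
  by_cases hx : x ∈ W
  · obtain ⟨w, hw, hw'⟩ := hx
    have h1 : Good (Pi.single e₀ ((SignType.sign (s e₀) : SignType) : ℝ)) := by
      rw [hsign]; exact hgoodB e₀ he₀
    have h2 := hgood_add _ _ hw h1
    refine Or.inl ⟨_, (hw'.add hxy.isUnitFlow).mem_flowSpace, fun h0 => ?_, h2.1, h2.2⟩
    rw [hsign, Pi.add_apply, Pi.single_eq_same] at h0
    have h3 := hw.2 e₀ he₀
    have h4 : w e₀ = - s e₀ := by linarith
    rw [h4] at h3
    rcases hs e₀ with h | h <;> rw [h] at h3 <;> norm_num at h3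
  · refine Or.inr ⟨potentialDiff R fun b => if b ∈ W then 1 else 0, ⟨_, rfl⟩, fun h0 => ?_,
      fun e he => ?_, fun e he => ?_⟩
    · have h1 := hxy.coe_mul fun b => if b ∈ W then 1 else 0
      rw [h0] at h1
      simp [hx, hyW] at h1
    · have h1 : R.tail e ∈ W ↔ R.head e ∈ W :=
        ⟨hstep e _ _ 1 (Or.inl ⟨rfl, rfl, rfl⟩) (hgoodA e he _),
          hstep e _ _ (-1) (Or.inr ⟨rfl, rfl, rfl⟩) (hgoodA e he _)⟩
      simp [potentialDiff_apply, h1]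
    · obtain ⟨b, c, hbc⟩ := harc e
      have h1 := hbc.coe_mul fun b => if b ∈ W then 1 else 0
      rw [hsign] at h1
      rw [mul_comm, h1]
      have h2 := hstep e b c _ hbc (by rw [hsign]; exact hgoodB e he)
      by_cases hb : b ∈ W
      · simp [hb, h2 hb]
      · simp only [hb, if_false, sub_zero]
        split_ifs <;> norm_num

lemma flow_eq_zero_of_acyclic (hV : V(G).Finite) {T : Set E(G)}
    (hT : ∀ C, IsCycle G C → ¬ C ⊆ T) {v : E(G) → ℝ} (hv : v ∈ flowSpace R)
    (hvT : ∀ e ∉ T, v e = 0) : v = 0 := by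
  by_contra hv0
  obtain ⟨P, hP, hP'⟩ := exists_isDirectedCycle hV v hv hv0
  refine hT _ hP.isCycle fun e he => ?_
  by_contra heT
  have := hP' e he
  rw [hvT e heT, sign_zero] at this
  exact he this

omit [Fintype E(G)] in
lemma potential_eq_of_reflTransGen {T : Set E(G)} {φ : V → ℝ}
    (hφ : ∀ e ∈ T, potentialDiff R φ e = 0) {x y : V}
    (h : Relation.ReflTransGen (fun a b => ∃ e ∈ T, G.IsLink (e : E) a b) x y) : φ x = φ y := by
  induction h with
  | refl => rfl
  | tail _ h ih =>
    obtain ⟨e, he, hl⟩ := h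
    obtain ⟨s, hs⟩ := exists_isArc_of_isLink R hl
    have := hs.coe_mul φ
    rw [hφ e he, mul_zero] at this
    linarith

omit [Fintype E(G)] in
lemma cut_eq_zero_of_connectedBy {T : Set E(G)} (hT : ConnectedBy G T) {u : E(G) → ℝ}
    (hu : u ∈ cutSpace R) (huT : ∀ e ∈ T, u e = 0) : u = 0 := by
  obtain ⟨φ, rfl⟩ := hu
  funext e
  rw [potentialDiff_apply, Pi.zero_apply, sub_eq_zero]
  exact potential_eq_of_reflTransGen huT
    (hT.2 _ (R.isLink e).right_mem _ (R.isLink e).left_mem)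

lemma exists_isUnitFlow_of_reflTransGen (R : ReferenceOrientation G) {T : Set E(G)} {x y : V}
    (h : Relation.ReflTransGen (fun a b => ∃ e ∈ T, G.IsLink (e : E) a b) x y) :
    ∃ w, (∀ e ∉ T, w e = 0) ∧ IsUnitFlow R w x y := by
  classical
  induction h with
  | refl => exact ⟨0, by simp, IsUnitFlow.zero x⟩
  | tail _ h ih =>
    obtain ⟨w, hw, hw'⟩ := ih
    obtain ⟨e, he, hl⟩ := h
    obtain ⟨s, hs⟩ := exists_isArc_of_isLink R hl
    refine ⟨w + Pi.single e (s : ℝ), fun f hf => ?_, hw'.add hs.isUnitFlow⟩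
    have : f ≠ e := fun h => hf (h ▸ he)
    simp [hw f hf, this]

lemma exists_isFundamentalCycle (R : ReferenceOrientation G) (hV : V(G).Finite) {T : Set E(G)}
    (hT : ConnectedBy G T) {e : E(G)} (he : e ∉ T) : ∃ C, IsFundamentalCycle G T e C := by
  classical
  obtain ⟨w, hw, hw'⟩ := exists_isUnitFlow_of_reflTransGen R
    (hT.2 _ (R.isLink e).right_mem _ (R.isLink e).left_mem)
  have harc : IsArc R e 1 (R.tail e) (R.head e) := Or.inl ⟨rfl, rfl, rfl⟩
  obtain ⟨P, hP, hP'⟩ := exists_isDirectedCycle hV _ (hw'.add harc.isUnitFlow).mem_flowSpace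
    fun h0 => by
      have := congrFun h0 e
      simp [hw e he] at this
  refine ⟨_, hP.isCycle, fun f hf => ?_⟩
  by_contra hfT
  simp only [Set.mem_union, Set.mem_singleton_iff, not_or] at hfT
  have := hP' f hf
  simp [hw f hfT.1, hfT.2] at this
  exact hf this

lemma exists_isFundamentalCocycle (R : ReferenceOrientation G) (hV : V(G).Finite) {T : Set E(G)}
    (hT : ∀ C, IsCycle G C → ¬ C ⊆ T) {e : E(G)} (he : e ∈ T) :
    ∃ D, IsFundamentalCocycle G T e D := by
  classical
  -- The side of the tail after removal of `e` from `T`. Reaching the head as well would close up to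
  -- a nonzero flow supported in the acyclic set `T`.
  let W : Set V := {b | ∃ w, (∀ f ∉ T \ {e}, w f = 0) ∧ IsUnitFlow R w (R.tail e) b}
  have hstep : ∀ f ∈ T \ {e}, ∀ b c t, IsArc R f t b c → b ∈ W → c ∈ W := by
    rintro f hf b c t h ⟨w, hw, hw'⟩
    refine ⟨w + Pi.single f (t : ℝ), fun f' hf' => ?_, hw'.add h.isUnitFlow⟩
    have : f' ≠ f := fun h => hf' (h ▸ hf)
    simp [hw f' hf', this]
  have htail : R.tail e ∈ W := ⟨0, by simp, IsUnitFlow.zero _⟩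
  have hhead : R.head e ∉ W := by
    rintro ⟨w, hw, hw'⟩
    have harc : IsArc R e (-1) (R.head e) (R.tail e) := Or.inr ⟨rfl, rfl, rfl⟩
    have h0 := flow_eq_zero_of_acyclic hV hT (hw'.add harc.isUnitFlow).mem_flowSpace
      fun f hf => by
        have : f ≠ e := fun h => hf (h ▸ he)
        simp [hw f (fun h => hf h.1), this]
    have := congrFun h0 e
    simp [hw e (by simp)] at this
  obtain ⟨P, hP, hP'⟩ := exists_isDirectedCocycle
    (potentialDiff R fun b => if b ∈ W then 1 else 0) ⟨_, rfl⟩ fun h0 => by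
      have := congrFun h0 e
      simp [potentialDiff_apply, htail, hhead] at this
  refine ⟨_, hP.isCocycle, fun f hf => ?_⟩
  by_contra hfT
  simp only [Set.mem_union, Set.mem_singleton_iff, Set.mem_compl_iff, not_or, not_not] at hfT
  have h1 : R.tail f ∈ W ↔ R.head f ∈ W :=
    ⟨hstep f hfT _ _ 1 (Or.inl ⟨rfl, rfl, rfl⟩), hstep f hfT _ _ (-1) (Or.inr ⟨rfl, rfl, rfl⟩)⟩
  have := hP' f hf
  simp [potentialDiff_apply, h1] at this
  exact hf this

lemma isSpanningTree_of_forall (R : ReferenceOrientation G) (hG : IsConnected G) {T : Set E(G)}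
    (hT : ∀ C, IsCycle G C → ¬ C ⊆ T) (hT' : ∀ D, IsCocycle G D → ¬ D ⊆ Tᶜ) :
    IsSpanningTree G T := by
  classical
  refine ⟨⟨hG.1, fun x hx y hy => ?_⟩, hT⟩
  by_contra hxy
  let W : Set V := {z | Relation.ReflTransGen (fun a b => ∃ e ∈ T, G.IsLink (e : E) a b) x z}
  have hxW : x ∈ W := Relation.ReflTransGen.refl
  have hyW : y ∉ W := hxy
  obtain ⟨P, hP, hP'⟩ := exists_isDirectedCocycle
    (potentialDiff R fun b => if b ∈ W then 1 else 0) ⟨_, rfl⟩ fun h0 => by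
      have := potential_eq_of_reflTransGen (fun e _ => congrFun h0 e) (hG.2 x hx y hy)
      simp [hxW, hyW] at this
  refine hT' _ hP.isCocycle fun e he heT => he ?_
  have h1 : R.tail e ∈ W ↔ R.head e ∈ W :=
    ⟨fun h => h.tail ⟨e, heT, R.isLink e⟩, fun h => h.tail ⟨e, heT, (R.isLink e).symm⟩⟩
  have := hP' e he
  simpa [potentialDiff_apply, h1] using this

end SpanningTrees

/-! ### The geometric map of trees and its extension. -/

section Signatures

variable {V E : Type*} {G : Graph V E} {R : ReferenceOrientation G}

lemma CycleSignature.isSignature (σ : CycleSignature R) :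
    IsSignature (IsDirectedCycle R) σ.dir where
  elementary := σ.isDirectedCycle
  exists_support_eq P hP := ⟨⟨_, hP.isCycle⟩, σ.support_dir _⟩
  injective C D h := by
    rw [σ.support_dir, σ.support_dir] at h
    exact Subtype.ext h

lemma CocycleSignature.isSignature (τ : CocycleSignature R) :
    IsSignature (IsDirectedCocycle R) τ.dir where
  elementary := τ.isDirectedCocycle
  exists_support_eq P hP := ⟨⟨_, hP.isCocycle⟩, τ.support_dir _⟩
  injective C D h := by
    rw [τ.support_dir, τ.support_dir] at h
    exact Subtype.ext h

lemma CycleSignature.IsAcyclic.acyclicFamily {σ : CycleSignature R}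
    [Fintype {C : Set E(G) // IsCycle G C}] (hσ : σ.IsAcyclic) : AcyclicFamily σ.dir :=
  fun a ha h => hσ a ha fun e => by rw [finsum_eq_sum_of_fintype]; exact h e

lemma CocycleSignature.IsAcyclic.acyclicFamily {τ : CocycleSignature R}
    [Fintype {D : Set E(G) // IsCocycle G D}] (hτ : τ.IsAcyclic) : AcyclicFamily τ.dir :=
  fun a ha h => hτ a ha fun e => by rw [finsum_eq_sum_of_fintype]; exact h e

lemma boolSign_eq_sign (O : DiscreteOrientation G) : boolSign O = DiscreteOrientation.sign O := rfl

variable {σ : CycleSignature R} {τ : CocycleSignature R}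

lemma exists_sign_eq {s : SignType} (hs : s ≠ 0) : ∃ b : Bool, (if b then 1 else -1) = s := by
  revert s
  decide

lemma exists_isGeometricImage [Fintype E(G)] (hV : V(G).Finite) (σ : CycleSignature R)
    (τ : CocycleSignature R) {T : Set E(G)} (hT : IsSpanningTree G T) :
    ∃ O, IsGeometricImage σ τ T O := by
  have hex : ∀ e, ∃ b : Bool,
      (e ∉ T → ∃ C, IsFundamentalCycle G T e C.1 ∧ (if b then 1 else -1) = σ.dir C e) ∧
      (e ∈ T → ∃ D, IsFundamentalCocycle G T e D.1 ∧ (if b then 1 else -1) = τ.dir D e) := by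
    intro e
    by_cases he : e ∈ T
    · obtain ⟨D, hD⟩ := exists_isFundamentalCocycle R hV hT.2 he
      have hne : τ.dir ⟨D, hD.1⟩ e ≠ 0 := by
        rw [← Function.mem_support, τ.support_dir]
        -- A cocycle in `Tᶜ ∪ {e}` avoiding `e` would miss the connected set `T`, forcing its vector
        -- to be zero.
        by_contra heD
        refine (τ.isDirectedCocycle ⟨D, hD.1⟩).ne_zero (toVec_injective
          ((cut_eq_zero_of_connectedBy hT.1 (τ.isDirectedCocycle ⟨D, hD.1⟩).mem_cutSpace
            fun f hf => ?_).trans (by funext; simp [toVec_apply])))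
        rw [toVec_eq_zero_iff]
        by_contra hne
        rw [← ne_eq, ← Function.mem_support, τ.support_dir] at hne
        rcases hD.2 hne with h | h
        exacts [h hf, heD (h ▸ hne)]
      obtain ⟨b, hb⟩ := exists_sign_eq hne
      exact ⟨b, fun h => absurd he h, fun _ => ⟨⟨D, hD.1⟩, hD, hb⟩⟩
    · obtain ⟨C, hC⟩ := exists_isFundamentalCycle R hV hT.1 he
      have hne : σ.dir ⟨C, hC.1⟩ e ≠ 0 := by
        rw [← Function.mem_support, σ.support_dir]
        by_contra heC
        refine hT.2 C hC.1 fun f hf => (hC.2 hf).resolve_right fun h => heC (h ▸ hf)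
      obtain ⟨b, hb⟩ := exists_sign_eq hne
      exact ⟨b, fun _ => ⟨⟨C, hC.1⟩, hC, hb⟩, fun h => absurd h he⟩
  choose O hO using hex
  exact ⟨O, hT, fun e he => (hO e).1 he, fun e he => (hO e).2 he⟩

lemma IsGeometricImage.optimal [Fintype E(G)] [Fintype {C : Set E(G) // IsCycle G C}]
    (hV : V(G).Finite) {T : Set E(G)} {O : DiscreteOrientation G}
    (h : IsGeometricImage σ τ T O) : Optimal (flowSpace R) σ.dir T (toVec (boolSign O)) :=
  fun _ hv hs => inCone_of_fundamental (toVec_boolSign_mem O)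
    (fun C => (σ.isDirectedCycle C).mem_flowSpace)
    (fun _ hv hvT => flow_eq_zero_of_acyclic hV h.1.2 hv hvT)
    (fun e he => by
      obtain ⟨C, hC, hCe⟩ := h.2.1 e he
      refine ⟨C, by rw [toVec_apply, toVec_apply, boolSign_eq_sign, hCe], fun f hf hfe => ?_⟩
      by_contra hne
      rw [← ne_eq, ← Function.mem_support, σ.support_dir] at hne
      exact (hC.2 hne).elim hf hfe) hv hs

lemma IsGeometricImage.optimal' [Fintype E(G)] [Fintype {D : Set E(G) // IsCocycle G D}]
    {T : Set E(G)} {O : DiscreteOrientation G} (h : IsGeometricImage σ τ T O) :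
    Optimal (cutSpace R) τ.dir Tᶜ (toVec (boolSign O)) :=
  fun _ hv hs => inCone_of_fundamental (toVec_boolSign_mem O)
    (fun C => (τ.isDirectedCocycle C).mem_cutSpace)
    (fun _ hv hvT => cut_eq_zero_of_connectedBy h.1.1 hv fun e he => hvT e (by simpa using he))
    (fun e he => by
      obtain ⟨D, hD, hDe⟩ := h.2.2 e (by simpa using he)
      refine ⟨D, by rw [toVec_apply, toVec_apply, boolSign_eq_sign, hDe], fun f hf hfe => ?_⟩
      by_contra hne
      rw [← ne_eq, ← Function.mem_support, τ.support_dir] at hne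
      exact (hD.2 hne).elim hf hfe) hv hs

variable [Fintype E(G)] [Fintype {C : Set E(G) // IsCycle G C}]
  [Fintype {D : Set E(G) // IsCocycle G D}]

/-- Uniqueness of fundamental cycles and cocycles is bypassed: optimality of one image and
pointedness of the cones already force the signs of the other. -/
lemma IsGeometricImage.orientation_eq (hV : V(G).Finite) (hσ : σ.IsAcyclic) (hτ : τ.IsAcyclic)
    {T : Set E(G)} {O O' : DiscreteOrientation G} (h : IsGeometricImage σ τ T O)
    (h' : IsGeometricImage σ τ T O') : O = O' := by
  refine toVec_boolSign_injective (funext fun e => ?_)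
  by_cases he : e ∈ T
  · obtain ⟨D, hD, hDe⟩ := h.2.2 e he
    refine h'.optimal'.sign_eq hτ.acyclicFamily (i := D)
      (τ.isDirectedCocycle D).mem_cutSpace (toVec_boolSign_mem O) (toVec_boolSign_mem O')
      (by rw [toVec_apply, toVec_apply, boolSign_eq_sign, hDe]) fun f hf hfe => ?_
    by_contra hne
    rw [← ne_eq, ← Function.mem_support, τ.support_dir] at hne
    exact (hD.2 hne).elim hf hfe
  · obtain ⟨C, hC, hCe⟩ := h.2.1 e he
    refine (h'.optimal hV).sign_eq hσ.acyclicFamily (i := C)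
      (σ.isDirectedCycle C).mem_flowSpace (toVec_boolSign_mem O) (toVec_boolSign_mem O')
      (by rw [toVec_apply, toVec_apply, boolSign_eq_sign, hCe]) fun f hf hfe => ?_
    by_contra hne
    rw [← ne_eq, ← Function.mem_support, σ.support_dir] at hne
    exact (hC.2 hne).elim hf hfe

/-- Every compatible orientation is the image of a spanning tree. -/
lemma exists_isGeometricImage_of_compatible (hV : V(G).Finite) (hG : IsConnected G)
    (hσ : σ.IsAcyclic) (hτ : τ.IsAcyclic) {O : DiscreteOrientation G} (hO : σ.Compatible O)
    (hO' : τ.Compatible O) : ∃ T, IsGeometricImage σ τ T O := by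
  have hbad := (compatibleWith_iff (isElementary_directedCycle hV) σ.isSignature).1 hO
  have hbad' := (compatibleWith_iff (isElementary_directedCocycle R) τ.isSignature).1 hO'
  obtain ⟨T, q, ⟨O₁, hT, rfl⟩, -, -, hq⟩ := hasBasis_of_noBad
    (B := fun T q => ∃ O, IsGeometricImage σ τ T O ∧ toVec (boolSign O) = q)
    (d := σ.dir) (d' := τ.dir)
    (fun C D => flow_cut_orthogonal _ (σ.isDirectedCycle C).mem_flowSpace _
      (τ.isDirectedCocycle D).mem_cutSpace)
    (by
      rintro T _ ⟨O, -, rfl⟩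
      exact toVec_boolSign_mem O)
    (by
      rintro T _ ⟨O, hO, rfl⟩ F D hF -
      exact (hO.optimal hV).noBad hσ.acyclicFamily
        (fun C => (σ.isDirectedCycle C).mem_flowSpace)
        (fun C => (σ.isDirectedCycle C).ne_zero) hF)
    (by
      rintro T _ ⟨O, hO, rfl⟩ F D - hD
      exact hO.optimal'.noBad hτ.acyclicFamily
        (fun C => (τ.isDirectedCocycle C).mem_cutSpace)
        (fun C => (τ.isDirectedCocycle C).ne_zero) hD)
    (by
      rintro T _ T' _ ⟨O, hO, rfl⟩ ⟨O', hO', rfl⟩ hag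
      exact basis_eq_of_agree (paintingProperty R) hσ.acyclicFamily hτ.acyclicFamily
        (toVec_boolSign_mem O) (hO.optimal hV) hO.optimal' (hO'.optimal hV) hO'.optimal' hag)
    (by
      intro T hT hT'
      obtain ⟨O, hO⟩ := exists_isGeometricImage hV σ τ (isSpanningTree_of_forall R hG
        (fun C hC hCT => hT ⟨C, hC⟩ fun e he => by
          by_contra hne
          rw [← ne_eq, ← Function.mem_support, σ.support_dir] at hne
          exact he (hCT hne))
        (fun D hD hDT => hT' ⟨D, hD⟩ fun e he => by
          by_contra hne
          rw [← ne_eq, ← Function.mem_support, τ.support_dir] at hne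
          exact hDT hne he))
      exact ⟨_, O, hO, rfl⟩)
    (toVec_boolSign_mem O) (Set.disjoint_empty ∅) hbad hbad'
  exact ⟨T, (toVec_boolSign_injective (funext fun e => hq e (by simp) (by simp)) : O₁ = O) ▸ hT⟩

lemma exists_isExtendedImage (hV : V(G).Finite) (hG : IsConnected G)
    (hσ : σ.IsAcyclic) (hτ : τ.IsAcyclic) (O : DiscreteOrientation G) :
    ∃ S, IsExtendedImage σ τ O S := by
  classical
  obtain ⟨O', 𝒞, 𝒟, hO', hO'', h𝒞, h𝒟, h𝒞d, h𝒟d, hdisj, hne⟩ :=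
    exists_compatible_reversal flow_cut_orthogonal (isElementary_directedCycle hV)
      (isElementary_directedCocycle R) σ.isSignature τ.isSignature hσ.acyclicFamily
      hτ.acyclicFamily O
  obtain ⟨T, hT⟩ := exists_isGeometricImage_of_compatible hV hG hσ hτ hO' hO''
  refine ⟨_, O', T, 𝒞, 𝒟, hO', hO'', h𝒞, h𝒟, h𝒞d, h𝒟d, hdisj, funext fun e => ?_, hT, rfl⟩
  have h1 : O e ≠ O' e ↔ e ∈ edgesOf 𝒞 ∪ edgesOf 𝒟 := hne e
  rw [reverse]
  split_ifs with h
  · rw [← h1] at h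
    revert h
    cases O e <;> cases O' e <;> decide
  · rw [← h1] at h
    exact not_not.1 h

lemma IsExtendedImage.exists_datum (hV : V(G).Finite) {O : DiscreteOrientation G}
    {S : Set E(G)} (h : IsExtendedImage σ τ O S) :
    ∃ (D : Datum (flowSpace R) (cutSpace R) σ.dir τ.dir) (O' : DiscreteOrientation G),
      D.o = toVec (boolSign O) ∧ D.S = S ∧ D.p = toVec (boolSign O') ∧
      IsGeometricImage σ τ D.T O' := by
  classical
  obtain ⟨O', T, 𝒞, 𝒟, -, -, h𝒞, h𝒟, h𝒞d, h𝒟d, hdisj, rfl, hT, rfl⟩ := h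
  obtain ⟨c, hcZ, hc, hc0⟩ := exists_sum_of_disjoint (Z := flowSpace R) (boolSign O') 𝒞
    (fun P hP => ⟨(h𝒞 P hP).1.mem_flowSpace, (h𝒞 P hP).2⟩) h𝒞d
  obtain ⟨c', hcZ', hc', hc0'⟩ := exists_sum_of_disjoint (Z := cutSpace R) (boolSign O') 𝒟
    (fun P hP => ⟨(h𝒟 P hP).1.mem_cutSpace, (h𝒟 P hP).2⟩) h𝒟d
  have hne : ∀ e, toVec (boolSign O') e ≠ 0 := fun e => by
    rcases toVec_boolSign_mem O' e with h | h <;> rw [h] <;> norm_num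
  have hmem : ∀ e, c e ≠ 0 ↔ e ∈ edgesOf 𝒞 := fun e =>
    ⟨fun h => by by_contra h'; exact h (hc0 e h'), fun h => by rw [hc e h]; exact hne e⟩
  have hmem' : ∀ e, c' e ≠ 0 ↔ e ∈ edgesOf 𝒟 := fun e =>
    ⟨fun h => by by_contra h'; exact h (hc0' e h'), fun h => by rw [hc' e h]; exact hne e⟩
  refine ⟨⟨T, toVec (boolSign O'), c, c', toVec_boolSign_mem O', hcZ, hcZ', fun e => ?_,
    fun e => ?_, fun e => ?_, hT.optimal hV, hT.optimal'⟩, O', funext fun e => ?_, ?_, rfl, hT⟩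
  · exact (em (e ∈ edgesOf 𝒞)).symm.imp (hc0 e) (hc e)
  · exact (em (e ∈ edgesOf 𝒟)).symm.imp (hc0' e) (hc' e)
  · by_contra! h
    exact Set.disjoint_left.1 hdisj ((hmem e).1 h.1) ((hmem' e).1 h.2)
  · simp only [Datum.o]
    rw [toVec_boolSign (reverse _ _), reverse]
    by_cases h1 : e ∈ edgesOf 𝒞
    · have h2 := Set.disjoint_left.1 hdisj h1
      rw [hc e h1, hc0' e h2, toVec_boolSign, if_pos (Set.mem_union_left _ h1)]
      cases O' e <;> norm_num
    · by_cases h2 : e ∈ edgesOf 𝒟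
      · rw [hc0 e h1, hc' e h2, toVec_boolSign, if_pos (Set.mem_union_right _ h2)]
        cases O' e <;> norm_num
      · rw [hc0 e h1, hc0' e h2, toVec_boolSign, 
          if_neg (show e ∉ edgesOf 𝒞 ∪ edgesOf 𝒟 from fun h => h.elim h1 h2)]
        cases O' e <;> norm_num
  · ext e
    have h1 := hmem e
    have h2 := not_congr (hmem' e)
    rw [ne_eq, not_not] at h2
    simp only [Datum.S, Set.mem_ofPred_eq, h1, h2, Set.mem_sdiff, Set.mem_union]

/-- Two pairs of the extended geometric map whose edge sets agree wherever the orientations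
differ are equal. -/
lemma IsExtendedImage.eq_of_agree (hV : V(G).Finite) (hσ : σ.IsAcyclic) (hτ : τ.IsAcyclic)
    {O₁ O₂ : DiscreteOrientation G} {S₁ S₂ : Set E(G)} (h₁ : IsExtendedImage σ τ O₁ S₁)
    (h₂ : IsExtendedImage σ τ O₂ S₂) (h : ∀ e, O₁ e ≠ O₂ e → (e ∈ S₁ ↔ e ∈ S₂)) :
    O₁ = O₂ ∧ S₁ = S₂ := by
  obtain ⟨D₁, O₁', ho₁, rfl, hp₁, hT₁⟩ := h₁.exists_datum hV
  obtain ⟨D₂, O₂', ho₂, rfl, hp₂, hT₂⟩ := h₂.exists_datum hV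
  obtain ⟨hc, hc', hT⟩ := Datum.Adjacent.eq (D₁ := D₁) (D₂ := D₂) (paintingProperty R)
    flow_cut_orthogonal hσ.acyclicFamily hτ.acyclicFamily fun e he => h e fun h0 => he (by
      rw [ho₁, ho₂, toVec_boolSign, toVec_boolSign, h0])
  rw [← hT] at hT₂
  have hO' := hT₁.orientation_eq hV hσ hτ hT₂
  have hp : D₁.p = D₂.p := by rw [hp₁, hp₂, hO']
  refine ⟨toVec_boolSign_injective ?_, ?_⟩
  · dsimp only
    rw [← ho₁, ← ho₂]
    funext e
    simp only [Datum.o, hp, hc, hc']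
  · simp only [Datum.S, hc, hc', hT]

end Signatures

/-! ### From the key lemma to the tiling of the cube. -/

section Tiling

variable {V E : Type*} {G : Graph V E}

lemma toPoint_eq_or (O : DiscreteOrientation G) (e : E(G)) :
    DiscreteOrientation.toPoint O e = 0 ∨ DiscreteOrientation.toPoint O e = 1 := by
  rw [DiscreteOrientation.toPoint]
  split_ifs <;> simp

lemma toPoint_injective {O O' : DiscreteOrientation G} {e : E(G)}
    (h : DiscreteOrientation.toPoint O e = DiscreteOrientation.toPoint O' e) : O e = O' e := by
  simp only [DiscreteOrientation.toPoint] at h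
  cases h1 : O e <;> cases h2 : O' e <;> first | rfl | simp [h1, h2] at h

/-- A coordinate fixed at a vertex value by one cell is neither interior nor the opposite value
required by the other. -/
lemma mem_of_mem_hoc_of_ne {O O' : DiscreteOrientation G} {S S' : Set E(G)} {x : E(G) → ℝ}
    (hx : x ∈ hoc O S) (hx' : x ∈ hoc O' S') {e : E(G)} (he : O e ≠ O' e) : e ∈ S := by
  by_contra hS
  have h1 := hx.2.1 e hS
  by_cases hS' : e ∈ S'
  · rcases hx'.2.2 e hS' with h2 | h2
    · exact he (toPoint_injective (h1.symm.trans h2))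
    · rw [h1] at h2
      rcases toPoint_eq_or O e with h | h <;> rw [h] at h2 <;> simp at h2
  · exact he (toPoint_injective (h1.symm.trans (hx'.2.1 e hS')))

/-- A bijection from orientations to edge sets such that different pairs are never adjacent
gives a covering of the cube by half-open cells. -/
lemma cube_subset_iUnion_hoc [Finite E(G)] (f : DiscreteOrientation G → Set E(G))
    (hf : ∀ O₁ O₂, (∀ e, O₁ e ≠ O₂ e → (e ∈ f O₁ ↔ e ∈ f O₂)) → O₁ = O₂) :
    cube G ⊆ ⋃ O, hoc O (f O) := by
  classical
  have hinj : Function.Injective f := fun O₁ O₂ h => hf O₁ O₂ fun e _ => by rw [h]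
  have := Fintype.ofFinite E(G)
  have hbij : Function.Bijective f :=
    (Fintype.bijective_iff_injective_and_card f).2 ⟨hinj, by simp⟩
  choose g hg using hbij.2
  -- Faces of the cube are coded by `Option Bool`, with `none` for a bi-oriented edge. The map `h`
  -- keeps the free edges of `F`, puts them into the set `S F`, and orients the remaining ones as
  -- the orientation whose image under `f` is `S F`.
  let S : (E(G) → Option Bool) → Set E(G) := fun F => {e | F e = none ∨ F e = some true}
  let h : (E(G) → Option Bool) → E(G) → Option Bool := fun F e =>
    if F e = none then none else some (g (S F) e)
  have hnone : ∀ F e, h F e = none ↔ F e = none := fun F e => by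
    simp only [h]
    split_ifs with h1 <;> simp [h1]
  have hsome : ∀ F e, F e ≠ none → h F e = some (g (S F) e) := fun F e he => if_neg he
  have hhinj : Function.Injective h := by
    intro F F' hFF
    have hnn : ∀ e, F e = none ↔ F' e = none := fun e => by
      rw [← hnone F, ← hnone F', hFF]
    -- If the codes under `h` agree, the two orientations differ only on free edges, and these
    -- belong to both sets.
    have hgg := hf (g (S F)) (g (S F')) fun e he => by
      by_cases hFe : F e = none
      · rw [hg, hg]
        exact iff_of_true (Or.inl hFe) (Or.inl ((hnn e).1 hFe))
      · refine absurd ?_ he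
        have h1 := congrFun hFF e
        rw [hsome F e hFe, hsome F' e (mt (hnn e).2 hFe)] at h1
        exact Option.some_injective _ h1
    have hSS : S F = S F' := by rw [← hg (S F), hgg, hg]
    funext e
    have h1 := Set.ext_iff.1 hSS e
    have h2 := hnn e
    simp only [S, Set.mem_ofPred_eq] at h1
    revert h1 h2
    generalize F e = a
    generalize F' e = b
    revert a b
    decide
  intro x hx
  have h01 : ∀ e, 0 ≤ x e ∧ x e ≤ 1 := fun e => ⟨hx.1 e, hx.2 e⟩
  -- Surjectivity of `h` applied to the face whose relative interior contains `x`.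
  obtain ⟨F, hF⟩ := Finite.surjective_of_injective hhinj
    fun e => if x e ∈ Set.Ioo (0 : ℝ) 1 then none else some (decide (x e = 1))
  have hpt : ∀ e, x e ∉ Set.Ioo (0 : ℝ) 1 →
      x e = DiscreteOrientation.toPoint (g (S F)) e := fun e he => by
    have h1 := congrFun hF e
    rw [if_neg he] at h1
    have h2 : F e ≠ none := fun h => by rw [(hnone F e).2 h] at h1; simp at h1
    rw [hsome F e h2] at h1
    rw [DiscreteOrientation.toPoint, Option.some_injective _ h1]
    by_cases hx1 : x e = 1
    · simp [hx1]
    · have hx0 : x e = 0 := by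
        by_contra hx0
        exact he ⟨lt_of_le_of_ne (h01 e).1 (Ne.symm hx0), lt_of_le_of_ne (h01 e).2 hx1⟩
      simp [hx0]
  refine Set.mem_iUnion.2 ⟨g (S F), hx, fun e he => hpt e fun hI => he ?_, fun e _ => ?_⟩
  · rw [hg]
    have h1 := congrFun hF e
    rw [if_pos hI, hnone] at h1
    exact Or.inl h1
  · exact (em _).symm.imp (hpt e) id

end Tiling

end CubeTiling

theorem theorem4p5 {V E : Type*} (G : Graph V E) (hV : V(G).Finite) (hE : E(G).Finite)
    (hG : CubeTiling.IsConnected G) (R : CubeTiling.ReferenceOrientation G)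
    (σ : CubeTiling.CycleSignature R) (hσ : σ.IsAcyclic)
    (τ : CubeTiling.CocycleSignature R) (hτ : τ.IsAcyclic) :
    (∀ (O : CubeTiling.DiscreteOrientation G) (S : Set E(G)),
      CubeTiling.IsExtendedImage σ τ O S ↔ S = CubeTiling.phi σ τ O) ∧
    (⋃ O : CubeTiling.DiscreteOrientation G, CubeTiling.hoc O (CubeTiling.phi σ τ O)) =
      CubeTiling.cube G ∧
    Pairwise fun O₁ O₂ : CubeTiling.DiscreteOrientation G =>
      Disjoint (CubeTiling.hoc O₁ (CubeTiling.phi σ τ O₁))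
        (CubeTiling.hoc O₂ (CubeTiling.phi σ τ O₂)) := by
  classical
  have : Fintype E(G) := hE.fintype
  have : Fintype {C : Set E(G) // CubeTiling.IsCycle G C} := Fintype.ofFinite _
  have : Fintype {D : Set E(G) // CubeTiling.IsCocycle G D} := Fintype.ofFinite _
  have hphi : ∀ O, CubeTiling.IsExtendedImage σ τ O (CubeTiling.phi σ τ O) := fun O =>
    Classical.epsilon_spec (CubeTiling.exists_isExtendedImage hV hG hσ hτ O)
  refine ⟨fun O S => ⟨fun h => ?_, fun h => h ▸ hphi O⟩, Set.Subset.antisymm ?_ ?_, ?_⟩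
  -- For a single orientation the agreement condition is vacuous, so rigidity is independence of
  -- choices.
  · exact (h.eq_of_agree hV hσ hτ (hphi O) fun e he => absurd rfl he).2
  · exact Set.iUnion_subset fun O x hx => hx.1
  · exact CubeTiling.cube_subset_iUnion_hoc _ fun O₁ O₂ h =>
      ((hphi O₁).eq_of_agree hV hσ hτ (hphi O₂) h).1
  · intro O₁ O₂ hne
    refine Set.disjoint_left.2 fun x hx₁ hx₂ => hne ?_
    exact ((hphi O₁).eq_of_agree hV hσ hτ (hphi O₂) fun e he =>
      iff_of_true (CubeTiling.mem_of_mem_hoc_of_ne hx₁ hx₂ he)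
        (CubeTiling.mem_of_mem_hoc_of_ne hx₂ hx₁ he.symm)).1
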